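/- Let $n\ge 1$ and let $\mathfrak g=\mathfrak{so}_{2n+1}(\mathbb C)$, of type $B_n$, with its usual Chevalley generators $e_k,f_k,h_k$ ($1\le k\le n$), where the simple roots are $\alpha_k=\varepsilon_k-\varepsilon_{k+1}$ for $k<n$ and $\alpha_n=\varepsilon_n$, and let $\omega_n=\frac12(\varepsilon_1+\dots+\varepsilon_n)$ be the fundamental weight with $\langle h_k,\omega_n\rangle=\delta_{kn}$. Let $\mathcal Y$ be the set of Young diagrams that fit inside an $n\times n$ box (at most $n$ rows, all of length at most $n$), where the vertex (box) in row $i$ and column $j$ has degree $n+j-i\in\{1,\dots,2n-1\}$, and let $\mathcal Y^{\mathbf a}\subset\mathcal Y$ be the set of self-conjugate diagrams. For $Y\in\mathcal Y^{\mathbf a}$ and $1\le k\le n-1$ let $\tilde f_k(Y)$ (resp. $\tilde e_k(Y)$) be the diagram in $\mathcal Y$ obtained from $Y$ by adding (resp. removing) one vertex of degree $k$ and one vertex of degree $2n-k$; let $\tilde f_n(Y)$ (resp. $\tilde e_n(Y)$) be the diagram in $\mathcal Y$ obtained from $Y$ by adding (resp. removing) one vertex of degree $n$; in each case the value is $0$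 if no such diagram exists (if it exists, it is unique and self-conjugate). Let $$\operatorname{wt}(Y)=\omega_n-\sum_{i=1}^n \#\{\text{vertices of } Y \text{ of degree } i\}\,\alpha_i .$$ Let $V$ be the complex vector space with basis $\mathcal Y^{\mathbf a}$. Then there is a unique representation of $\mathfrak g$ on $V$ in which $e_k$ and $f_k$ act by the linear extensions of $\tilde e_k$ and $\tilde f_k$, and $h_k$ acts by the linear extension of $Y\mapsto\langle h_k,\operatorname{wt}(Y)\rangle\,Y$, for all $1\le k\le n$. This representation is irreducible, contains a highest weight vector of weight $\omega_n$, and is isomorphic to the spin representation $V(\omega_n)$, the irreducible quotient of the Verma module of highest weight $\omega_n$. -/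

import Mathlib

attribute [local instance 100] LieRing.ofAssociativeRing

noncomputable section

namespace SpinRep

open Matrix

/-! ## The Lie algebra `𝔰𝔬(2n+1, ℂ)` and its Chevalley generators

`𝔰𝔬(2n+1, ℂ)` is realized as the Lie algebra of the symmetric bilinear form
`2 u₀² + ∑ (vᵢ wᵢ + wᵢ vᵢ)` on `ℂ^(2n+1)`, with basis `u₀, v₁, …, vₙ, w₁, …, wₙ`.
Throughout, `k : Fin n` stands for the node `k + 1` of the Dynkin diagram of type `Bₙ`; the last
node is the short simple root. -/

/-- Index set of the standard basis of `ℂ^(2n+1)`. -/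
abbrev Idx (n : ℕ) := Unit ⊕ (Fin n ⊕ Fin n)

/-- The index of the basis vector `u₀`. -/
abbrev u0 (n : ℕ) : Idx n := Sum.inl ()

/-- The index of the basis vector `vᵢ`. -/
abbrev vI {n : ℕ} (i : Fin n) : Idx n := Sum.inr (Sum.inl i)

/-- The index of the basis vector `wᵢ`. -/
abbrev wI {n : ℕ} (i : Fin n) : Idx n := Sum.inr (Sum.inr i)

/-- The Lie algebra `𝔰𝔬(2n+1, ℂ)` of type `Bₙ`. -/
abbrev so (n : ℕ) : LieSubalgebra ℂ (Matrix (Idx n) (Idx n) ℂ) :=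
  LieAlgebra.Orthogonal.typeB (Fin n) ℂ

/-- `Hᵢ = E_{vᵢ vᵢ} - E_{wᵢ wᵢ}`; these form a basis of the diagonal Cartan subalgebra. -/
def cartanMat {n : ℕ} (i : Fin n) : Matrix (Idx n) (Idx n) ℂ :=
  single (vI i) (vI i) 1 - single (wI i) (wI i) 1

/-- Root vector of the simple root `εₖ - εₖ₊₁` (`k < n`), respectively `εₙ` (`k = n`). -/
def eMat {n : ℕ} (k : Fin n) : Matrix (Idx n) (Idx n) ℂ :=
  if h : (k : ℕ) + 1 < n then
    single (vI k) (vI ⟨k + 1, h⟩) 1 - single (wI ⟨k + 1, h⟩) (wI k) 1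
  else single (vI k) (u0 n) 2 - single (u0 n) (wI k) 1

/-- Root vector of the negative of the `k`-th simple root. -/
def fMat {n : ℕ} (k : Fin n) : Matrix (Idx n) (Idx n) ℂ :=
  if h : (k : ℕ) + 1 < n then
    single (vI ⟨k + 1, h⟩) (vI k) 1 - single (wI k) (wI ⟨k + 1, h⟩) 1
  else single (u0 n) (vI k) 1 - single (wI k) (u0 n) 2

/-- The simple coroot `Hₖ - Hₖ₊₁` (`k < n`), respectively `2 Hₙ` (`k = n`). -/
def hMat {n : ℕ} (k : Fin n) : Matrix (Idx n) (Idx n) ℂ :=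
  if h : (k : ℕ) + 1 < n then cartanMat k - cartanMat ⟨k + 1, h⟩
  else (2 : ℂ) • cartanMat k

theorem mem_so_iff {n : ℕ} (A : Matrix (Idx n) (Idx n) ℂ) :
    A ∈ so n ↔ Aᵀ * LieAlgebra.Orthogonal.JB (Fin n) ℂ =
      LieAlgebra.Orthogonal.JB (Fin n) ℂ * (-A) := by
  unfold so LieAlgebra.Orthogonal.typeB
  rw [mem_skewAdjointMatricesLieSubalgebra, mem_skewAdjointMatricesSubmodule]
  rfl

theorem single_u0_mul_JB {n : ℕ} (a : Idx n) (c : ℂ) :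
    single a (u0 n) c * LieAlgebra.Orthogonal.JB (Fin n) ℂ = single a (u0 n) (c * 2) := by
  ext x (y | y | y) <;> by_cases h : a = x <;>
    simp [LieAlgebra.Orthogonal.JB, LieAlgebra.Orthogonal.JD, single, mul_apply, h]

theorem single_vI_mul_JB {n : ℕ} (a : Idx n) (i : Fin n) (c : ℂ) :
    single a (vI i) c * LieAlgebra.Orthogonal.JB (Fin n) ℂ = single a (wI i) c := by
  ext x (y | y | y) <;> by_cases h : a = x <;>
    simp [LieAlgebra.Orthogonal.JB, LieAlgebra.Orthogonal.JD, single, mul_apply, one_apply, h]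

theorem single_wI_mul_JB {n : ℕ} (a : Idx n) (i : Fin n) (c : ℂ) :
    single a (wI i) c * LieAlgebra.Orthogonal.JB (Fin n) ℂ = single a (vI i) c := by
  ext x (y | y | y) <;> by_cases h : a = x <;>
    simp [LieAlgebra.Orthogonal.JB, LieAlgebra.Orthogonal.JD, single, mul_apply, one_apply, h]

theorem JB_transpose (n : ℕ) :
    (LieAlgebra.Orthogonal.JB (Fin n) ℂ)ᵀ = LieAlgebra.Orthogonal.JB (Fin n) ℂ := by
  simp [LieAlgebra.Orthogonal.JB, LieAlgebra.Orthogonal.JD, fromBlocks_transpose]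

theorem JB_mul_single_u0 {n : ℕ} (a : Idx n) (c : ℂ) :
    LieAlgebra.Orthogonal.JB (Fin n) ℂ * single (u0 n) a c = single (u0 n) a (c * 2) := by
  simpa [transpose_mul, JB_transpose] using congrArg transpose (single_u0_mul_JB a c)

theorem JB_mul_single_vI {n : ℕ} (a : Idx n) (i : Fin n) (c : ℂ) :
    LieAlgebra.Orthogonal.JB (Fin n) ℂ * single (vI i) a c = single (wI i) a c := by
  simpa [transpose_mul, JB_transpose] using congrArg transpose (single_vI_mul_JB a i c)

theorem JB_mul_single_wI {n : ℕ} (a : Idx n) (i : Fin n) (c : ℂ) :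
    LieAlgebra.Orthogonal.JB (Fin n) ℂ * single (wI i) a c = single (vI i) a c := by
  simpa [transpose_mul, JB_transpose] using congrArg transpose (single_wI_mul_JB a i c)

theorem cartanMat_mem {n : ℕ} (i : Fin n) : cartanMat i ∈ so n := by
  rw [mem_so_iff]
  simp [cartanMat, sub_mul, mul_sub, single_vI_mul_JB, single_wI_mul_JB, JB_mul_single_vI,
    JB_mul_single_wI]

theorem eMat_mem {n : ℕ} (k : Fin n) : eMat k ∈ so n := by
  rw [mem_so_iff]
  unfold eMat
  split_ifs <;> simp [sub_mul, mul_sub, single_u0_mul_JB, single_vI_mul_JB, single_wI_mul_JB,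
    JB_mul_single_u0, JB_mul_single_vI, JB_mul_single_wI]

theorem fMat_mem {n : ℕ} (k : Fin n) : fMat k ∈ so n := by
  rw [mem_so_iff]
  unfold fMat
  split_ifs <;> simp [sub_mul, mul_sub, single_u0_mul_JB, single_vI_mul_JB, single_wI_mul_JB,
    JB_mul_single_u0, JB_mul_single_vI, JB_mul_single_wI]

theorem hMat_mem {n : ℕ} (k : Fin n) : hMat k ∈ so n := by
  unfold hMat
  split_ifs with h
  · exact sub_mem (cartanMat_mem k) (cartanMat_mem _)
  · exact (so n).smul_mem _ (cartanMat_mem k)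

/-- The Chevalley generator `eₖ` of `𝔰𝔬(2n+1, ℂ)`. -/
def chevE {n : ℕ} (k : Fin n) : so n := ⟨eMat k, eMat_mem k⟩

/-- The Chevalley generator `fₖ` of `𝔰𝔬(2n+1, ℂ)`. -/
def chevF {n : ℕ} (k : Fin n) : so n := ⟨fMat k, fMat_mem k⟩

/-- The Chevalley generator `hₖ` of `𝔰𝔬(2n+1, ℂ)`. -/
def chevH {n : ℕ} (k : Fin n) : so n := ⟨hMat k, hMat_mem k⟩

/-! ## Weights

A weight `μ`, i.e. a linear functional on the diagonal Cartan subalgebra, is given by its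
coordinates `μ i = μ(Hᵢ)`, that is `μ = ∑ i, μ i • εᵢ`. -/

/-- The weights of `𝔰𝔬(2n+1, ℂ)`. -/
abbrev Weight (n : ℕ) := Fin n → ℂ

/-- The value `⟨hₖ, μ⟩` of the weight `μ` on the simple coroot `hₖ`. -/
def pairing {n : ℕ} (k : Fin n) (μ : Weight n) : ℂ :=
  if h : (k : ℕ) + 1 < n then μ k - μ ⟨k + 1, h⟩ else 2 * μ k

/-- The simple root `αₖ`: `εₖ - εₖ₊₁` for `k < n` and `εₙ` for `k = n`. -/
def simpleRoot {n : ℕ} (k : Fin n) : Weight n :=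
  if h : (k : ℕ) + 1 < n then Pi.single k 1 - Pi.single ⟨k + 1, h⟩ 1 else Pi.single k 1

/-- The fundamental weight `ωₙ = (ε₁ + ⋯ + εₙ) / 2` of the spin representation. -/
def spinWeight (n : ℕ) : Weight n := fun _ => 1 / 2

/-- `ωₙ` is the last fundamental weight: it takes the value `1` on `hₙ` and `0` on the other
simple coroots. -/
theorem pairing_spinWeight {n : ℕ} (k : Fin n) :
    pairing k (spinWeight n) = if (k : ℕ) + 1 = n then 1 else 0 := by
  have := k.2
  unfold pairing spinWeight
  split_ifs <;> first | omega | norm_num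

/-! ## The irreducible highest weight representation `V(μ)` -/

/-- The universal enveloping algebra of `𝔰𝔬(2n+1, ℂ)`. -/
abbrev U (n : ℕ) := UniversalEnvelopingAlgebra ℂ (so n)

/-- The left ideal of the enveloping algebra generated by the `eₖ` and the `hₖ - ⟨hₖ, μ⟩`. -/
def vermaIdeal {n : ℕ} (μ : Weight n) : Submodule (U n) (U n) :=
  Submodule.span (U n)
    (Set.range (fun k : Fin n => UniversalEnvelopingAlgebra.ι ℂ (chevE k)) ∪
      Set.range (fun k : Fin n => UniversalEnvelopingAlgebra.ι ℂ (chevH k) -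
        algebraMap ℂ (U n) (pairing k μ)))

/-- The Verma module of highest weight `μ`. -/
abbrev Verma {n : ℕ} (μ : Weight n) := U n ⧸ vermaIdeal μ

/-- The largest proper submodule of the Verma module: the sum of all proper submodules. -/
def vermaRadical {n : ℕ} (μ : Weight n) : Submodule (U n) (Verma μ) :=
  sSup {N : Submodule (U n) (Verma μ) | N ≠ ⊤}

/-- The space of the irreducible representation `V(μ)` of highest weight `μ`: the irreducible
quotient of the Verma module. -/
abbrev Irrep {n : ℕ} (μ : Weight n) := Verma μ ⧸ vermaRadical μ

/-- The action of `𝔰𝔬(2n+1, ℂ)` on `V(μ)`, through the enveloping algebra. -/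
def irrepAction {n : ℕ} (μ : Weight n) : so n →ₗ⁅ℂ⁆ Module.End ℂ (Irrep μ) :=
  (Algebra.lsmul ℂ ℂ (Irrep μ)).toLieHom.comp (UniversalEnvelopingAlgebra.ι ℂ)

theorem irrepAction_apply {n : ℕ} (μ : Weight n) (x : so n) (v : Irrep μ) :
    irrepAction μ x v = UniversalEnvelopingAlgebra.ι ℂ x • v := rfl

/-! ## Representations -/

/-- A representation is irreducible if it is nonzero and has no invariant subspaces other than
`0` and the whole space. -/
def IsIrreducibleRep {n : ℕ} {V : Type*} [AddCommGroup V] [Module ℂ V]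
    (ρ : so n →ₗ⁅ℂ⁆ Module.End ℂ V) : Prop :=
  Nontrivial V ∧ ∀ W : Submodule ℂ V, (∀ x : so n, ∀ v ∈ W, ρ x v ∈ W) → W = ⊥ ∨ W = ⊤

/-- `v` is a highest weight vector of weight `μ`. -/
def IsHighestWeightVector {n : ℕ} {V : Type*} [AddCommGroup V] [Module ℂ V]
    (ρ : so n →ₗ⁅ℂ⁆ Module.End ℂ V) (μ : Weight n) (v : V) : Prop :=
  v ≠ 0 ∧ (∀ k, ρ (chevE k) v = 0) ∧ ∀ k, ρ (chevH k) v = pairing k μ • v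

/-- Two representations are isomorphic: there is a linear isomorphism that commutes with the
actions. -/
def RepIso {n : ℕ} {V W : Type*} [AddCommGroup V] [Module ℂ V] [AddCommGroup W] [Module ℂ W]
    (ρ : so n →ₗ⁅ℂ⁆ Module.End ℂ V) (σ : so n →ₗ⁅ℂ⁆ Module.End ℂ W) : Prop :=
  ∃ φ : V ≃ₗ[ℂ] W, ∀ (x : so n) (v : V), φ (ρ x v) = σ x (φ v)

/-! ## Young diagrams in the `n × n` box

A vertex in row `i` and column `j` (counted from `0`) has degree `n + j - i`, so that the degrees
run from `1` to `2n - 1` and the diagonal vertices have degree `n`. Transposition exchanges the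
degrees `d` and `2n - d`. -/

/-- The degree of a vertex of a Young diagram. -/
def degree (n : ℕ) (c : ℕ × ℕ) : ℤ := (n : ℤ) + c.2 - c.1

/-- The diagram `Y` has at most `n` rows and all its rows have length at most `n`. -/
def InBox (n : ℕ) (Y : YoungDiagram) : Prop := ∀ c ∈ Y, c.1 < n ∧ c.2 < n

/-- The self-conjugate Young diagrams that fit inside an `n × n` box. -/
abbrev SelfConj (n : ℕ) := {Y : YoungDiagram // InBox n Y ∧ Y.transpose = Y}

/-- `Y'` is obtained from `Y` by adding a vertex of degree `d`. -/
def AddsOne (n : ℕ) (d : ℤ) (Y Y' : YoungDiagram) : Prop :=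
  ∃ c, degree n c = d ∧ c ∉ Y.cells ∧ Y'.cells = insert c Y.cells

/-- `Y'` is obtained from `Y` by adding a vertex of degree `d₁` and a vertex of degree `d₂`. -/
def AddsTwo (n : ℕ) (d₁ d₂ : ℤ) (Y Y' : YoungDiagram) : Prop :=
  ∃ c₁ c₂, degree n c₁ = d₁ ∧ degree n c₂ = d₂ ∧ c₁ ≠ c₂ ∧ c₁ ∉ Y.cells ∧ c₂ ∉ Y.cells ∧
    Y'.cells = insert c₁ (insert c₂ Y.cells)

/-- With `k' = k + 1` the node of the Dynkin diagram: `Y'` is obtained from `Y` by adding vertices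
of degrees `k'` and `2n - k'` if `k' < n`, and by adding a vertex of degree `n` if `k' = n`. -/
def Adds {n : ℕ} (k : Fin n) (Y Y' : YoungDiagram) : Prop :=
  if (k : ℕ) + 1 < n then AddsTwo n ((k : ℤ) + 1) (2 * n - ((k : ℤ) + 1)) Y Y'
  else AddsOne n n Y Y'

/-- Two addable vertices of the same degree coincide. -/
theorem eq_of_degree_eq {n : ℕ} {Y Y' Y'' : YoungDiagram} {c c' : ℕ × ℕ}
    (hd : degree n c = degree n c') (hY : c ∉ Y.cells) (hY' : c' ∉ Y.cells)
    (hc : c ∈ Y'.cells) (hc' : c' ∈ Y''.cells)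
    (h' : ∀ x ∈ Y'.cells, x ∉ Y.cells → degree n x = degree n c → x = c)
    (h'' : ∀ x ∈ Y''.cells, x ∉ Y.cells → degree n x = degree n c → x = c') : c = c' := by
  simp only [degree] at hd
  rcases le_total c.1 c'.1 with h | h
  · exact h'' c (Y''.isLowerSet (show c ≤ c' from ⟨h, by omega⟩) hc') hY rfl
  · exact (h' c' (Y'.isLowerSet (show c' ≤ c from ⟨h, by omega⟩) hc) hY'
      (by simp only [degree]; omega)).symm

/-- Two removable vertices of the same degree coincide. -/
theorem eq_of_degree_eq_left {n : ℕ} {Y Y' Y'' : YoungDiagram} {c c' : ℕ × ℕ}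
    (hd : degree n c = degree n c') (hY : c ∈ Y.cells) (hY' : c' ∈ Y.cells)
    (hc : c ∉ Y'.cells) (hc' : c' ∉ Y''.cells)
    (h' : ∀ x ∈ Y.cells, x ∉ Y'.cells → degree n x = degree n c → x = c)
    (h'' : ∀ x ∈ Y.cells, x ∉ Y''.cells → degree n x = degree n c → x = c') : c = c' := by
  simp only [degree] at hd
  rcases le_total c.1 c'.1 with h | h
  · refine (h' c' hY' (fun hx => hc (Y'.isLowerSet (show c ≤ c' from ⟨h, by omega⟩) hx)) ?_).symm
    simp only [degree]; omega
  · exact h'' c hY (fun hx => hc' (Y''.isLowerSet (show c' ≤ c from ⟨h, by omega⟩) hx)) rfl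

/-- There is at most one way to add the vertices. -/
theorem Adds.unique {n : ℕ} {k : Fin n} {Y Y' Y'' : YoungDiagram}
    (h' : Adds k Y Y') (h'' : Adds k Y Y'') : Y' = Y'' := by
  unfold Adds at h' h''
  split_ifs at h' h'' with hk
  · obtain ⟨a, b, ha, hb, hab, haY, hbY, e'⟩ := h'
    obtain ⟨a', b', ha', hb', hab', haY', hbY', e''⟩ := h''
    have h1 : a = a' := by
      refine eq_of_degree_eq (n := n) (Y := Y) (Y' := Y') (Y'' := Y'') (by rw [ha, ha']) haY haY'
        (by simp [e']) (by simp [e'']) ?_ ?_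
      · intro x hx hxY hd
        simp only [e', Finset.mem_insert] at hx
        rcases hx with rfl | rfl | hx
        · rfl
        · omega
        · exact absurd hx hxY
      · intro x hx hxY hd
        simp only [e'', Finset.mem_insert] at hx
        rcases hx with rfl | rfl | hx
        · rfl
        · omega
        · exact absurd hx hxY
    have h2 : b = b' := by
      refine eq_of_degree_eq (n := n) (Y := Y) (Y' := Y') (Y'' := Y'') (by rw [hb, hb']) hbY hbY'
        (by simp [e']) (by simp [e'']) ?_ ?_
      · intro x hx hxY hd
        simp only [e', Finset.mem_insert] at hx
        rcases hx with rfl | rfl | hx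
        · omega
        · rfl
        · exact absurd hx hxY
      · intro x hx hxY hd
        simp only [e'', Finset.mem_insert] at hx
        rcases hx with rfl | rfl | hx
        · omega
        · rfl
        · exact absurd hx hxY
    subst h1 h2
    exact YoungDiagram.ext (e'.trans e''.symm)
  · obtain ⟨a, ha, haY, e'⟩ := h'
    obtain ⟨a', ha', haY', e''⟩ := h''
    have h1 : a = a' := by
      refine eq_of_degree_eq (n := n) (Y := Y) (Y' := Y') (Y'' := Y'') (by rw [ha, ha']) haY haY'
        (by simp [e']) (by simp [e'']) ?_ ?_
      · intro x hx hxY hd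
        simp only [e', Finset.mem_insert] at hx
        exact hx.resolve_right hxY
      · intro x hx hxY hd
        simp only [e'', Finset.mem_insert] at hx
        exact hx.resolve_right hxY
    subst h1
    exact YoungDiagram.ext (e'.trans e''.symm)

/-- There is at most one way to remove the vertices. -/
theorem Adds.unique_left {n : ℕ} {k : Fin n} {Y Y' Y'' : YoungDiagram}
    (h' : Adds k Y' Y) (h'' : Adds k Y'' Y) : Y' = Y'' := by
  unfold Adds at h' h''
  split_ifs at h' h'' with hk
  · obtain ⟨a, b, ha, hb, hab, haY, hbY, e'⟩ := h'
    obtain ⟨a', b', ha', hb', hab', haY', hbY', e''⟩ := h''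
    have key : ∀ x, x ∈ Y.cells → (x = a ∨ x = b ∨ x ∈ Y'.cells) := by
      intro x hx; simpa [e'] using hx
    have key' : ∀ x, x ∈ Y.cells → (x = a' ∨ x = b' ∨ x ∈ Y''.cells) := by
      intro x hx; simpa [e''] using hx
    have h1 : a = a' := by
      refine eq_of_degree_eq_left (n := n) (Y := Y) (Y' := Y') (Y'' := Y'') (by rw [ha, ha'])
        (by simp [e']) (by simp [e'']) haY haY' ?_ ?_
      · intro x hx hxY hd
        rcases key x hx with rfl | rfl | hx
        · rfl
        · omega
        · exact absurd hx hxY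
      · intro x hx hxY hd
        rcases key' x hx with rfl | rfl | hx
        · rfl
        · omega
        · exact absurd hx hxY
    have h2 : b = b' := by
      refine eq_of_degree_eq_left (n := n) (Y := Y) (Y' := Y') (Y'' := Y'') (by rw [hb, hb'])
        (by simp [e']) (by simp [e'']) hbY hbY' ?_ ?_
      · intro x hx hxY hd
        rcases key x hx with rfl | rfl | hx
        · omega
        · rfl
        · exact absurd hx hxY
      · intro x hx hxY hd
        rcases key' x hx with rfl | rfl | hx
        · omega
        · rfl
        · exact absurd hx hxY
    subst h1 h2
    apply YoungDiagram.ext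
    ext x
    have e := congrArg (x ∈ ·) (e'.symm.trans e'')
    simp only [Finset.mem_insert, eq_iff_iff] at e
    by_cases hxa : x = a
    · subst hxa; simp [haY, haY']
    by_cases hxb : x = b
    · subst hxb; simp [hbY, hbY']
    simpa [hxa, hxb] using e
  · obtain ⟨a, ha, haY, e'⟩ := h'
    obtain ⟨a', ha', haY', e''⟩ := h''
    have key : ∀ x, x ∈ Y.cells → (x = a ∨ x ∈ Y'.cells) := by
      intro x hx; simpa [e'] using hx
    have key' : ∀ x, x ∈ Y.cells → (x = a' ∨ x ∈ Y''.cells) := by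
      intro x hx; simpa [e''] using hx
    have h1 : a = a' :=
      eq_of_degree_eq_left (n := n) (Y := Y) (Y' := Y') (Y'' := Y'') (by rw [ha, ha'])
        (by simp [e']) (by simp [e'']) haY haY'
        (fun x hx hxY _ => (key x hx).resolve_right hxY)
        (fun x hx hxY _ => (key' x hx).resolve_right hxY)
    subst h1
    apply YoungDiagram.ext
    ext x
    have e := congrArg (x ∈ ·) (e'.symm.trans e'')
    simp only [Finset.mem_insert, eq_iff_iff] at e
    by_cases hxa : x = a
    · subst hxa; simp [haY, haY']
    simpa [hxa] using e

theorem Adds.transpose {n : ℕ} {k : Fin n} {Y Y' : YoungDiagram} (h : Adds k Y Y') :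
    Adds k Y.transpose Y'.transpose := by
  have mem : ∀ (Z : YoungDiagram) (x : ℕ × ℕ), x ∈ Z.transpose.cells ↔ x.swap ∈ Z.cells := by
    intro Z x
    simp only [YoungDiagram.mem_cells, YoungDiagram.mem_transpose]
  have sw : ∀ x y : ℕ × ℕ, x.swap = y ↔ x = y.swap := fun x y => Prod.swap_eq_iff_eq_swap
  unfold Adds at h ⊢
  split_ifs at h ⊢ with hk
  · obtain ⟨a, b, ha, hb, hab, haY, hbY, e⟩ := h
    refine ⟨b.swap, a.swap, ?_, ?_, ?_, ?_, ?_, ?_⟩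
    · simp only [degree, Prod.fst_swap, Prod.snd_swap] at *; omega
    · simp only [degree, Prod.fst_swap, Prod.snd_swap] at *; omega
    · simpa using hab.symm
    · simpa [mem] using hbY
    · simpa [mem] using haY
    · ext x
      simp only [mem, e, Finset.mem_insert, sw]
      tauto
  · obtain ⟨a, ha, haY, e⟩ := h
    refine ⟨a.swap, ?_, ?_, ?_⟩
    · simp only [degree, Prod.fst_swap, Prod.snd_swap] at *; omega
    · simpa [mem] using haY
    · ext x
      simp only [mem, e, Finset.mem_insert, sw]

/-- Adding vertices to a self-conjugate diagram yields a self-conjugate one. -/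
theorem Adds.selfConj {n : ℕ} {k : Fin n} {Y Y' : YoungDiagram} (h : Adds k Y Y')
    (hY : Y.transpose = Y) : Y'.transpose = Y' :=
  Adds.unique (hY ▸ h.transpose) h

/-- Removing vertices from a self-conjugate diagram yields a self-conjugate one. -/
theorem Adds.selfConj_left {n : ℕ} {k : Fin n} {Y Y' : YoungDiagram} (h : Adds k Y Y')
    (hY : Y'.transpose = Y') : Y.transpose = Y :=
  Adds.unique_left (hY ▸ h.transpose) h

open Classical in
/-- The crystal operator `f̃ₖ`; `none` stands for the ghost partition. -/
def crystalF {n : ℕ} (k : Fin n) (Y : SelfConj n) : Option (SelfConj n) :=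
  if h : ∃ Y' : YoungDiagram, InBox n Y' ∧ Adds k Y Y' then
    some ⟨h.choose, h.choose_spec.1, h.choose_spec.2.selfConj Y.2.2⟩
  else none

open Classical in
/-- The crystal operator `ẽₖ`; `none` stands for the ghost partition. -/
def crystalE {n : ℕ} (k : Fin n) (Y : SelfConj n) : Option (SelfConj n) :=
  if h : ∃ Y' : YoungDiagram, InBox n Y' ∧ Adds k Y' Y then
    some ⟨h.choose, h.choose_spec.1, h.choose_spec.2.selfConj_left Y.2.2⟩
  else none

/-- The weight `ωₙ - ∑ᵢ #{vertices of Y of degree i} αᵢ`, the sum running over the nodes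
`1, …, n`. -/
def wt {n : ℕ} (Y : SelfConj n) : Weight n :=
  spinWeight n -
    ∑ i : Fin n, ((Y.1.cells.filter (fun c => degree n c = (i : ℤ) + 1)).card : ℂ) • simpleRoot i

/-! ## The space spanned by the self-conjugate diagrams -/

/-- The complex vector space with basis the self-conjugate diagrams in the `n × n` box. -/
abbrev DiagramSpace (n : ℕ) := SelfConj n →₀ ℂ

/-- The basis vector of a diagram; the ghost partition is identified with zero. -/
def diagramVec {n : ℕ} : Option (SelfConj n) → DiagramSpace n
  | none => 0
  | some Y => Finsupp.single Y 1

/-- The linear extension of `ẽₖ`. -/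
def opE {n : ℕ} (k : Fin n) : Module.End ℂ (DiagramSpace n) :=
  Finsupp.linearCombination ℂ (fun Y => diagramVec (crystalE k Y))

/-- The linear extension of `f̃ₖ`. -/
def opF {n : ℕ} (k : Fin n) : Module.End ℂ (DiagramSpace n) :=
  Finsupp.linearCombination ℂ (fun Y => diagramVec (crystalF k Y))

/-- The linear extension of `Y ↦ ⟨hₖ, wt Y⟩ Y`. -/
def opH {n : ℕ} (k : Fin n) : Module.End ℂ (DiagramSpace n) :=
  Finsupp.linearCombination ℂ (fun Y => pairing k (wt Y) • diagramVec (some Y))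

/-- In the representation `ρ` on the diagram space, the Chevalley generators act by the linear
extensions of the crystal operators and by the weight. -/
def ActsByCrystal {n : ℕ} (ρ : so n →ₗ⁅ℂ⁆ Module.End ℂ (DiagramSpace n)) : Prop :=
  ∀ k : Fin n, ρ (chevE k) = opE k ∧ ρ (chevF k) = opF k ∧ ρ (chevH k) = opH k

end SpinRep

end

noncomputable section

namespace SpinRep

open Matrix

/-! ## Wedge products of vectors in `𝔰𝔬(2n+1, ℂ)` -/

/-! Elements of `so n` are combinations of wedges of basis vectors, and any operators with
anticommutators given by the Gram matrix turn wedges into antisymmetrised products, hence yield a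
representation (`cliffordHom`). On the space with basis the subsets of an `n`-element set such
operators are removal and insertion of elements, for `vᵢ` and `wᵢ`, and parity, for `u₀`. The signs
count absent elements, so that they cancel in every `eₖ` and `fₖ`: these move `k` to `k + 1` or
back, and at the last node remove or insert the last element.

A self-conjugate diagram is determined by its numbers of vertices of degree `0, 1, …, n`. This
sequence starts at zero and grows by zero or one at each step, so it is encoded by the subset of
steps where it grows. Raising one count alone moves an element of that subset, so `Adds` is exactly
the action above (`adds_iff_of_lt`, `adds_iff_of_not_lt`), and summation by parts matches the
weights (`wt_apply`). This gives existence; uniqueness holds because the `eₖ` and `fₖ` generate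
(`eq_top_of_chevalley_mem`).

For irreducibility, distinct diagrams never merge under `eₖ`, so a nonzero vector of an invariant
subspace can be lowered to a multiple of the empty diagram (`single_empty_mem`), from which the `fₖ`
build every diagram (`single_mem`).

For the comparison with `V(ωₙ)`, `rhoCheck` grades words in the `fₖ` by length. A polynomial in it
isolates the highest weight component (`mem_of_smul_add_mem`), so proper submodules of the Verma
module have no such component, and the radical is the kernel of the map onto the given irreducible
representation (`repIso_irrepAction`). No basis theorem for the enveloping algebra is needed. -/

/-- The Gram matrix of the symmetric bilinear form defining `𝔰𝔬(2n+1, ℂ)`. -/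
abbrev gram (n : ℕ) : Matrix (Idx n) (Idx n) ℂ := LieAlgebra.Orthogonal.JB (Fin n) ℂ

section Gram

variable {n : ℕ} (i j : Fin n)

@[simp] theorem gram_u0_u0 : gram n (u0 n) (u0 n) = 2 := by
  simp [gram, LieAlgebra.Orthogonal.JB]

@[simp] theorem gram_u0_inr (x : Fin n ⊕ Fin n) : gram n (u0 n) (Sum.inr x) = 0 := by
  simp [gram, LieAlgebra.Orthogonal.JB]

@[simp] theorem gram_inr_u0 (x : Fin n ⊕ Fin n) : gram n (Sum.inr x) (u0 n) = 0 := by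
  simp [gram, LieAlgebra.Orthogonal.JB]

@[simp] theorem gram_v_v : gram n (vI i) (vI j) = 0 := by
  simp [gram, LieAlgebra.Orthogonal.JB, LieAlgebra.Orthogonal.JD]

@[simp] theorem gram_w_w : gram n (wI i) (wI j) = 0 := by
  simp [gram, LieAlgebra.Orthogonal.JB, LieAlgebra.Orthogonal.JD]

@[simp] theorem gram_v_w : gram n (vI i) (wI j) = if i = j then 1 else 0 := by
  simp [gram, LieAlgebra.Orthogonal.JB, LieAlgebra.Orthogonal.JD, one_apply]

@[simp] theorem gram_w_v : gram n (wI i) (vI j) = if i = j then 1 else 0 := by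
  simp [gram, LieAlgebra.Orthogonal.JB, LieAlgebra.Orthogonal.JD, one_apply]

end Gram

/-- The standard basis vector of `ℂ^(2n+1)`. -/
abbrev stdVec {n : ℕ} (a : Idx n) : Idx n → ℂ := Pi.single a 1

/-- The matrix `z ↦ B(y, z) x - B(x, z) y`. -/
def wedgeMat {n : ℕ} (x y : Idx n → ℂ) : Matrix (Idx n) (Idx n) ℂ :=
  (vecMulVec x y - vecMulVec y x) * gram n

theorem wedgeMat_mem {n : ℕ} (x y : Idx n → ℂ) : wedgeMat x y ∈ so n := by
  rw [mem_so_iff, wedgeMat, transpose_mul, JB_transpose, transpose_sub, transpose_vecMulVec,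
    transpose_vecMulVec, Matrix.mul_assoc, ← neg_mul, neg_sub]

/-- The element `z ↦ B(y, z) x - B(x, z) y` of `𝔰𝔬(2n+1, ℂ)`. -/
def wedge {n : ℕ} (x y : Idx n → ℂ) : so n := ⟨wedgeMat x y, wedgeMat_mem x y⟩

section Bilinear

variable {n : ℕ} (x y z : Idx n → ℂ) (c : ℂ)

@[simp] theorem wedge_self : wedge x x = 0 := by
  ext1; simp [wedge, wedgeMat]

theorem wedge_smul_left : wedge (c • x) y = c • wedge x y := by
  ext1; simp [wedge, wedgeMat, smul_vecMulVec, vecMulVec_smul, ← smul_sub]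

theorem wedge_smul_right : wedge x (c • y) = c • wedge x y := by
  ext1; simp [wedge, wedgeMat, smul_vecMulVec, vecMulVec_smul, ← smul_sub]

theorem wedge_swap : wedge x y = -wedge y x := by
  ext1; simp [wedge, wedgeMat, ← neg_mul]

/-- Skewness of `A` for the form moves it past the Gram matrix as `-Aᵀ`, so the adjoint action is
the derivation action on bivectors. -/
theorem lie_wedge (A : so n) : ⁅A, wedge x y⁆ = wedge (A.1 *ᵥ x) y + wedge x (A.1 *ᵥ y) := by
  apply Subtype.ext
  have h' : gram n * A.1 = -(A.1ᵀ * gram n) := by rw [(mem_so_iff A.1).1 A.2]; simp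
  change A.1 * wedgeMat x y - wedgeMat x y * A.1 =
    wedgeMat (A.1 *ᵥ x) y + wedgeMat x (A.1 *ᵥ y)
  simp only [wedgeMat]
  rw [Matrix.mul_assoc _ (gram n), h', mul_neg, ← Matrix.mul_assoc, ← Matrix.mul_assoc, mul_sub,
    sub_mul (vecMulVec x y), mul_vecMulVec, mul_vecMulVec, vecMulVec_mul x, vecMulVec_mul y,
    vecMul_transpose, vecMul_transpose]
  simp only [sub_mul]
  abel

theorem wedge_mulVec :
    (wedge x y).1 *ᵥ z = (y ⬝ᵥ gram n *ᵥ z) • x - (x ⬝ᵥ gram n *ᵥ z) • y := by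
  simp only [wedge, wedgeMat, ← mulVec_mulVec, sub_mulVec, vecMulVec_mulVec]
  ext; simp [mul_comm]

end Bilinear

/-! ### Wedges of basis vectors and the Chevalley generators -/

section Basis

variable {n : ℕ}

theorem wedge_stdVec_mulVec (a b c : Idx n) :
    (wedge (stdVec a) (stdVec b)).1 *ᵥ stdVec c =
      gram n b c • stdVec a - gram n a c • stdVec b := by
  rw [wedge_mulVec]; simp

theorem wedge_stdVec (a b : Idx n) :
    (wedge (stdVec a) (stdVec b)).1 = (single a b 1 - single b a 1) * gram n := by
  simp [wedge, wedgeMat, single_eq_single_vecMulVec_single]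

theorem chevE_of_lt {k : Fin n} (h : (k : ℕ) + 1 < n) :
    chevE k = wedge (stdVec (vI k)) (stdVec (wI ⟨k + 1, h⟩)) := by
  ext1; rw [wedge_stdVec, sub_mul, single_wI_mul_JB, single_vI_mul_JB]; simp [chevE, eMat, h]

theorem chevE_of_not_lt {k : Fin n} (h : ¬ (k : ℕ) + 1 < n) :
    chevE k = wedge (stdVec (vI k)) (stdVec (u0 n)) := by
  ext1; rw [wedge_stdVec, sub_mul, single_u0_mul_JB, single_vI_mul_JB]; simp [chevE, eMat, h]

theorem chevF_of_lt {k : Fin n} (h : (k : ℕ) + 1 < n) :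
    chevF k = wedge (stdVec (vI ⟨k + 1, h⟩)) (stdVec (wI k)) := by
  ext1; rw [wedge_stdVec, sub_mul, single_wI_mul_JB, single_vI_mul_JB]; simp [chevF, fMat, h]

theorem chevF_of_not_lt {k : Fin n} (h : ¬ (k : ℕ) + 1 < n) :
    chevF k = wedge (stdVec (u0 n)) (stdVec (wI k)) := by
  ext1; rw [wedge_stdVec, sub_mul, single_wI_mul_JB, single_u0_mul_JB]; simp [chevF, fMat, h]

/-- The basis element `Hᵢ` of the diagonal Cartan subalgebra. -/
def cartan (i : Fin n) : so n := wedge (stdVec (vI i)) (stdVec (wI i))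

theorem coe_cartan (i : Fin n) : (cartan i).1 = cartanMat i := by
  rw [cartan, wedge_stdVec, sub_mul, single_wI_mul_JB, single_vI_mul_JB]; rfl

theorem chevH_of_lt {k : Fin n} (h : (k : ℕ) + 1 < n) :
    chevH k = cartan k - cartan ⟨k + 1, h⟩ := by
  ext1; simp [chevH, hMat, h, coe_cartan]

theorem chevH_of_not_lt {k : Fin n} (h : ¬ (k : ℕ) + 1 < n) :
    chevH k = (2 : ℂ) • cartan k := by
  ext1; simp [chevH, hMat, h, coe_cartan]

theorem lie_wedge_stdVec (a b c d : Idx n) :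
    ⁅wedge (stdVec a) (stdVec b), wedge (stdVec c) (stdVec d)⁆ =
      gram n b c • wedge (stdVec a) (stdVec d) - gram n a c • wedge (stdVec b) (stdVec d)
      + gram n b d • wedge (stdVec c) (stdVec a) - gram n a d • wedge (stdVec c) (stdVec b) := by
  rw [lie_wedge, wedge_stdVec_mulVec, wedge_stdVec_mulVec]
  simp only [sub_eq_add_neg, ← neg_smul]
  have hl : ∀ (x y z : Idx n → ℂ), wedge (x + y) z = wedge x z + wedge y z := by
    intro x y z
    ext1; simp [wedge, wedgeMat, add_vecMulVec, vecMulVec_add, ← add_mul]; congr 1; abel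
  have hr : ∀ (x y z : Idx n → ℂ), wedge x (y + z) = wedge x y + wedge x z := by
    intro x y z
    ext1; simp [wedge, wedgeMat, add_vecMulVec, vecMulVec_add, ← add_mul]; congr 1; abel
  simp only [hl, hr, wedge_smul_left, wedge_smul_right]
  abel

/-! ## Generation by the Chevalley generators -/

/-- The inverse of the Gram matrix. -/
def gramInv (n : ℕ) : Matrix (Idx n) (Idx n) ℂ :=
  fromBlocks ((1 / 2 : ℂ) • 1) 0 0 (LieAlgebra.Orthogonal.JD (Fin n) ℂ)

theorem gramInv_mul_gram (n : ℕ) : gramInv n * gram n = 1 := by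
  simp [gramInv, gram, LieAlgebra.Orthogonal.JB, LieAlgebra.Orthogonal.JD, fromBlocks_multiply]

theorem gram_mul_gramInv (n : ℕ) : gram n * gramInv n = 1 := by
  simp [gramInv, gram, LieAlgebra.Orthogonal.JB, LieAlgebra.Orthogonal.JD, fromBlocks_multiply]

theorem gramInv_transpose (n : ℕ) : (gramInv n)ᵀ = gramInv n := by
  simp [gramInv, LieAlgebra.Orthogonal.JD, fromBlocks_transpose]

theorem gramInv_mul_transpose (A : so n) : gramInv n * A.1ᵀ = -(A.1 * gramInv n) := by
  have h := congrArg (fun X => gramInv n * X * gramInv n) ((mem_so_iff A.1).1 A.2)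
  simp only [Matrix.mul_assoc, gram_mul_gramInv, Matrix.mul_one] at h
  rw [h, ← Matrix.mul_assoc, gramInv_mul_gram]
  simp

theorem eq_sum_single_sub_single {m : Type*} [Fintype m] [DecidableEq m] (M : Matrix m m ℂ)
    (hM : Mᵀ = -M) :
    M = ∑ a, ∑ b, ((1 / 2 : ℂ) * M a b) • (single a b (1 : ℂ) - single b a 1) := by
  ext i j
  have hij : M j i = -M i j := congrFun₂ hM i j
  simp [Matrix.sum_apply, single_apply, mul_sub, Finset.sum_sub_distrib, ite_and, hij]
  ring

/-- Membership in `so n` makes `A * gramInv n` skew, and a skew matrix is half the sum of its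
antisymmetrised matrix units; multiplying back by the Gram matrix gives wedges. -/
theorem exists_sum_wedge (A : so n) :
    A = ∑ a, ∑ b, ((1 / 2 : ℂ) * (A.1 * gramInv n) a b) • wedge (stdVec a) (stdVec b) := by
  apply Subtype.ext
  set M := A.1 * gramInv n with hM
  have hskew : Mᵀ = -M := by
    rw [hM, transpose_mul, gramInv_transpose, gramInv_mul_transpose]
  have hA : A.1 = M * gram n := by rw [hM, Matrix.mul_assoc, gramInv_mul_gram, Matrix.mul_one]
  have hsum : (∑ a, ∑ b, ((1 / 2 : ℂ) * M a b) • wedge (stdVec a) (stdVec b)).1 =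
      (∑ a, ∑ b, ((1 / 2 : ℂ) * M a b) • (single a b (1 : ℂ) - single b a 1)) * gram n := by
    simp only [AddSubmonoidClass.coe_finsetSum, Finset.sum_mul, smul_mul, ← wedge_stdVec]
    rfl
  rw [hsum, hA]
  exact congrArg (· * gram n) (eq_sum_single_sub_single M hskew)

/-- Only the pairing of `u₀` with itself survives, and it equals 2. Hence wedges with `u₀` generate
all the others. -/
theorem lie_wedge_u0 (a b : Idx n) (ha : a ≠ u0 n) (hb : b ≠ u0 n) :
    ⁅wedge (stdVec a) (stdVec (u0 n)), wedge (stdVec b) (stdVec (u0 n))⁆ =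
      (2 : ℂ) • wedge (stdVec b) (stdVec a) := by
  rw [lie_wedge_stdVec]
  rcases a with a | a
  · exact absurd rfl ha
  rcases b with b | b
  · exact absurd rfl hb
  simp

/-- The Chevalley generators `eₖ`, `fₖ` generate `𝔰𝔬(2n+1, ℂ)`. -/
theorem eq_top_of_chevalley_mem (L : LieSubalgebra ℂ (so n)) (hE : ∀ k, chevE k ∈ L)
    (hF : ∀ k, chevF k ∈ L) : L = ⊤ := by
  -- Induction on the distance `d` to the last node, whose generators are these wedges up to sign;
  -- bracketing with `eᵢ` or `fᵢ` passes from index `i + 1` to `i`.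
  have hvw : ∀ d : ℕ, ∀ i : Fin n, (i : ℕ) + 1 + d = n →
      wedge (stdVec (vI i)) (stdVec (u0 n)) ∈ L ∧ wedge (stdVec (wI i)) (stdVec (u0 n)) ∈ L := by
    intro d
    induction d with
    | zero =>
      intro i hi
      have h : ¬ (i : ℕ) + 1 < n := by omega
      refine ⟨chevE_of_not_lt h ▸ hE i, ?_⟩
      rw [wedge_swap, ← chevF_of_not_lt h]
      exact neg_mem (hF i)
    | succ d ih =>
      intro i hi
      have h : (i : ℕ) + 1 < n := by omega
      obtain ⟨hv, hw⟩ := ih ⟨i + 1, h⟩ (by simp; omega)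
      constructor
      · have := L.lie_mem (hE i) hv
        rw [chevE_of_lt h, lie_wedge_stdVec] at this
        simpa using this
      · have := L.lie_mem (hF i) hw
        rw [chevF_of_lt h, lie_wedge_stdVec] at this
        simpa using this
  have hu : ∀ a : Idx n, wedge (stdVec a) (stdVec (u0 n)) ∈ L := by
    rintro (a | a | a)
    · simp
    · exact (hvw (n - (a + 1)) a (by omega)).1
    · exact (hvw (n - (a + 1)) a (by omega)).2
  have hall : ∀ a b : Idx n, wedge (stdVec a) (stdVec b) ∈ L := by
    intro a b
    by_cases hb : b = u0 n
    · exact hb ▸ hu a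
    by_cases ha : a = u0 n
    · rw [ha, wedge_swap]; exact neg_mem (hu b)
    have := L.smul_mem (1 / 2 : ℂ) (L.lie_mem (hu b) (hu a))
    rw [lie_wedge_u0 b a hb ha, smul_smul] at this
    simpa using this
  rw [eq_top_iff]
  intro A _
  rw [exists_sum_wedge A]
  exact sum_mem fun a _ => sum_mem fun b _ => L.smul_mem _ (hall a b)

/-! ## Chevalley relations -/

theorem lie_chevE_chevF (k j : Fin n) :
    ⁅chevE k, chevF j⁆ = if k = j then chevH k else 0 := by
  by_cases hk : (k : ℕ) + 1 < n <;> by_cases hj : (j : ℕ) + 1 < n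
  · rw [chevE_of_lt hk, chevF_of_lt hj, lie_wedge_stdVec]
    by_cases h : k = j
    · subst h
      rw [if_pos rfl, chevH_of_lt hk, cartan, cartan]
      simp [sub_eq_add_neg]
    · have : (k : ℕ) ≠ j := fun e => h (Fin.ext e)
      simp [h, this]
  · rw [chevE_of_lt hk, chevF_of_not_lt hj, lie_wedge_stdVec]
    have h : k ≠ j := by rintro rfl; exact hj hk
    simp [h]
  · rw [chevE_of_not_lt hk, chevF_of_lt hj, lie_wedge_stdVec]
    have h : k ≠ j := by rintro rfl; exact hk hj
    simp [h]
  · have h : k = j := by ext; omega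
    subst h
    rw [chevE_of_not_lt hk, chevF_of_not_lt hj, lie_wedge_stdVec, if_pos rfl,
      chevH_of_not_lt hk, cartan]
    simp

theorem lie_cartan_chevF (i j : Fin n) :
    ⁅cartan i, chevF j⁆ = -simpleRoot j i • chevF j := by
  by_cases hj : (j : ℕ) + 1 < n
  · rw [cartan, chevF_of_lt hj, lie_wedge_stdVec]
    by_cases h1 : i = j
    · subst h1
      have h2 : i ≠ ⟨i + 1, hj⟩ := by simp [Fin.ext_iff]
      simp [simpleRoot, hj, h2]
    · by_cases h2 : i = ⟨j + 1, hj⟩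
      · have h3 : (⟨j + 1, hj⟩ : Fin n) ≠ j := h2 ▸ h1
        simp [simpleRoot, hj, h2, h3]
      · simp [simpleRoot, hj, h1, h2]
  · rw [cartan, chevF_of_not_lt hj, lie_wedge_stdVec]
    by_cases h1 : i = j
    · subst h1
      simp [simpleRoot, hj]
    · simp [simpleRoot, hj, h1]

end Basis

/-! ## Highest weight representations -/

open UniversalEnvelopingAlgebra in
-- The map into `B` lifts to the enveloping algebra; followed by the inclusion it fixes the
-- generators, so it is the identity, and its values lie in `B`.
theorem mem_of_forall_ι_mem {R L : Type*} [CommRing R] [LieRing L] [LieAlgebra R L]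
    (B : Subalgebra R (UniversalEnvelopingAlgebra R L)) (hB : ∀ x : L, ι R x ∈ B)
    (u : UniversalEnvelopingAlgebra R L) : u ∈ B := by
  let f : L →ₗ⁅R⁆ B :=
    { toFun := fun x => ⟨ι R x, hB x⟩
      map_add' := fun x y => Subtype.ext (map_add _ x y)
      map_smul' := fun c x => Subtype.ext (map_smul _ c x)
      map_lie' := fun {x y} => Subtype.ext (LieHom.map_lie _ x y) }
  have h : B.val.comp (lift R f) = AlgHom.id R _ := by
    ext x
    simp [f]
  have := congrArg (fun g => g u) h
  simp only [AlgHom.comp_apply, AlgHom.id_apply] at this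
  rw [← this]
  exact (lift R f u).2

theorem aeval_apply_mem {R M : Type*} [CommRing R] [AddCommGroup M] [Module R M]
    (D : Module.End R M) (N : Submodule R M) (hN : ∀ x ∈ N, D x ∈ N) (p : Polynomial R) :
    ∀ x ∈ N, Polynomial.aeval D p x ∈ N := by
  induction p using Polynomial.induction_on' with
  | add p q hp hq =>
    intro x hx
    rw [map_add]
    exact N.add_mem (hp x hx) (hq x hx)
  | monomial k a =>
    intro x hx
    rw [Polynomial.aeval_monomial, Module.End.mul_apply, Module.algebraMap_end_apply]
    refine N.smul_mem _ ?_
    induction k with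
    | zero => simpa using hx
    | succ k ih => rw [pow_succ', Module.End.mul_apply]; exact hN _ ih

theorem aeval_apply_of_eigen {R M : Type*} [CommRing R] [AddCommGroup M] [Module R M]
    (D : Module.End R M) {x : M} {c : R} (h : D x = c • x) (p : Polynomial R) :
    Polynomial.aeval D p x = p.eval c • x := by
  induction p using Polynomial.induction_on' with
  | add p q hp hq => simp [hp, hq, add_smul]
  | monomial k a =>
    rw [Polynomial.aeval_monomial, Module.End.mul_apply, Module.algebraMap_end_apply,
      Polynomial.eval_monomial, mul_smul]
    congr 1
    induction k with
    | zero => simp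
    | succ k ih => rw [pow_succ', Module.End.mul_apply, ih, map_smul, h, smul_smul, pow_succ]

/-! ### Words in the lowering operators applied to a highest weight vector -/

section Words

variable {n : ℕ} {M : Type*} [AddCommGroup M] [Module ℂ M] (σ : so n →ₗ⁅ℂ⁆ Module.End ℂ M)
  (m : M)

theorem apply_lie (x y : so n) (z : M) : σ ⁅x, y⁆ z = σ x (σ y z) - σ y (σ x z) := by
  rw [LieHom.map_lie, LieRing.of_associative_ring_bracket]
  rfl

theorem apply_apply_comm (x y : so n) (z : M) : σ x (σ y z) = σ y (σ x z) + σ ⁅x, y⁆ z := by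
  rw [apply_lie]; abel

/-- The vector obtained from `m` by applying a word in the `fₖ`. -/
def fWord (w : List (Fin n)) : M := w.foldr (fun k x => σ (chevF k) x) m

@[simp] theorem fWord_nil : fWord σ m [] = m := rfl

@[simp] theorem fWord_cons (k : Fin n) (w : List (Fin n)) :
    fWord σ m (k :: w) = σ (chevF k) (fWord σ m w) := rfl

/-- A subspace invariant under the `eₖ` and `fₖ` is invariant. -/
theorem apply_mem_of_chevalley (N : Submodule ℂ M) (hE : ∀ k, ∀ z ∈ N, σ (chevE k) z ∈ N)
    (hF : ∀ k, ∀ z ∈ N, σ (chevF k) z ∈ N) (x : so n) : ∀ z ∈ N, σ x z ∈ N := by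
  let L : LieSubalgebra ℂ (so n) :=
    { carrier := {x | ∀ z ∈ N, σ x z ∈ N}
      add_mem' := fun {a b} ha hb z hz => by
        simpa using N.add_mem (ha z hz) (hb z hz)
      zero_mem' := fun z _ => by simp
      smul_mem' := fun c a ha z hz => by simpa using N.smul_mem c (ha z hz)
      lie_mem' := fun {a b} ha hb z hz => by
        simp only [apply_lie]
        exact N.sub_mem (ha _ (hb z hz)) (hb _ (ha z hz)) }
  have h : L = ⊤ := eq_top_of_chevalley_mem L hE hF
  have hx : x ∈ L := h ▸ LieSubalgebra.mem_top x
  exact hx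

variable {μ : Weight n}

/-- The coroots are triangular in the `Hᵢ`: the last one is `2 Hₙ`, and `Hᵢ` is recovered from `hᵢ`
and `Hᵢ₊₁`. -/
theorem cartan_apply_of_chevH_apply (hH : ∀ k, σ (chevH k) m = pairing k μ • m) (i : Fin n) :
    σ (cartan i) m = μ i • m := by
  have key : ∀ d : ℕ, ∀ i : Fin n, (i : ℕ) + 1 + d = n → σ (cartan i) m = μ i • m := by
    intro d
    induction d with
    | zero =>
      intro i hi
      have h : ¬ (i : ℕ) + 1 < n := by omega
      have := hH i
      rw [chevH_of_not_lt h] at this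
      simp only [map_smul, LinearMap.smul_apply, pairing, h, dif_neg, not_false_iff, mul_smul]
        at this
      exact smul_right_injective M (two_ne_zero (α := ℂ)) this
    | succ d ih =>
      intro i hi
      have h : (i : ℕ) + 1 < n := by omega
      have := hH i
      rw [chevH_of_lt h] at this
      simp only [map_sub, LinearMap.sub_apply, pairing, h, dif_pos, sub_smul] at this
      rw [ih ⟨i + 1, h⟩ (by simp; omega)] at this
      exact sub_left_injective this
  exact key (n - (i + 1)) i (by omega)

theorem cartan_fWord (hC : ∀ i, σ (cartan i) m = μ i • m) (i : Fin n) (w : List (Fin n)) :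
    σ (cartan i) (fWord σ m w) = (μ i - (w.map fun k => simpleRoot k i).sum) • fWord σ m w := by
  induction w with
  | nil => simpa using hC i
  | cons k w ih =>
    rw [fWord_cons, apply_apply_comm, ih, lie_cartan_chevF, map_smul, map_smul,
      LinearMap.smul_apply, ← add_smul, List.map_cons, List.sum_cons]
    congr 1
    ring

/-- The element of the Cartan subalgebra on which every simple root takes the value `1`. -/
def rhoCheck (n : ℕ) : so n := ∑ i : Fin n, ((n : ℂ) - i) • cartan i

/-- The coefficients `n - i` drop by one from each index to the next, and the last of them is one.
-/
theorem sum_simpleRoot (k : Fin n) : ∑ i : Fin n, ((n : ℂ) - i) * simpleRoot k i = 1 := by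
  unfold simpleRoot
  split_ifs with h
  · simp [mul_sub, Finset.sum_sub_distrib, Pi.single_apply]
  · have : (n : ℂ) = k + 1 := by
      have : n = k + 1 := by omega
      exact_mod_cast this
    simp [Pi.single_apply, this]

theorem rhoCheck_fWord (hC : ∀ i, σ (cartan i) m = μ i • m) (w : List (Fin n)) :
    σ (rhoCheck n) (fWord σ m w) =
      (∑ i : Fin n, ((n : ℂ) - i) * μ i - w.length) • fWord σ m w := by
  have hw : ∑ i : Fin n, ((n : ℂ) - i) * (w.map fun k => simpleRoot k i).sum = w.length := by
    induction w with
    | nil => simp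
    | cons k w ih =>
      simp only [List.map_cons, List.sum_cons, mul_add, Finset.sum_add_distrib, ih,
        sum_simpleRoot, List.length_cons]
      push_cast
      ring
  rw [rhoCheck, map_sum, LinearMap.sum_apply]
  simp only [map_smul, LinearMap.smul_apply, cartan_fWord σ m hC, smul_smul]
  rw [← Finset.sum_smul, ← hw, ← Finset.sum_sub_distrib]
  simp only [mul_sub]

/-- The span of the vectors obtained from `m` by nonempty words in the `fₖ`. -/
def properWords : Submodule ℂ M := Submodule.span ℂ (fWord σ m '' {w | w ≠ []})

/-- Each nonempty word is an eigenvector whose eigenvalue differs from the top one by its nonzero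
length, so a linear factor kills it without vanishing at the top eigenvalue. Products of such
factors handle sums. -/
theorem exists_polynomial (hC : ∀ i, σ (cartan i) m = μ i • m) {y : M}
    (hy : y ∈ properWords σ m) :
    ∃ p : Polynomial ℂ, Polynomial.aeval (σ (rhoCheck n)) p y = 0 ∧
      p.eval (∑ i : Fin n, ((n : ℂ) - i) * μ i) ≠ 0 := by
  refine Submodule.span_induction ?_ ?_ ?_ ?_ hy
  · rintro _ ⟨w, hw, rfl⟩
    have heig := rhoCheck_fWord σ m hC w
    generalize ∑ i : Fin n, ((n : ℂ) - i) * μ i = c at heig ⊢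
    refine ⟨Polynomial.X - Polynomial.C (c - w.length), ?_, ?_⟩
    · rw [aeval_apply_of_eigen _ heig]
      simp
    · have : w.length ≠ 0 := by simpa using hw
      simpa using this
  · exact ⟨1, by simp, by simp⟩
  · rintro x y _ _ ⟨p, hp, hp'⟩ ⟨q, hq, hq'⟩
    refine ⟨p * q, ?_, by simpa using ⟨hp', hq'⟩⟩
    rw [map_add, map_mul, Module.End.mul_apply, Module.End.mul_apply, hq, map_zero, add_zero,
      ← Module.End.mul_apply, ← map_mul, mul_comm, map_mul, Module.End.mul_apply, hp, map_zero]
  · rintro c x _ ⟨p, hp, hp'⟩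
    exact ⟨p, by rw [map_smul, hp, smul_zero], hp'⟩

/-- A polynomial in `rhoCheck` that kills `y` preserves `N` and leaves a nonzero multiple of `m`. -/
theorem mem_of_smul_add_mem (hC : ∀ i, σ (cartan i) m = μ i • m) {y : M}
    (hy : y ∈ properWords σ m) (N : Submodule ℂ M) (hN : ∀ x : so n, ∀ z ∈ N, σ x z ∈ N)
    {c : ℂ} (hc : c ≠ 0) (h : c • m + y ∈ N) : m ∈ N := by
  obtain ⟨p, hp, hp'⟩ := exists_polynomial σ m hC hy
  have hD : σ (rhoCheck n) m = (∑ i : Fin n, ((n : ℂ) - i) * μ i) • m := by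
    simpa using rhoCheck_fWord σ m hC []
  have := aeval_apply_mem (σ (rhoCheck n)) N (hN _) p _ h
  rw [map_add, map_smul, hp, add_zero, aeval_apply_of_eigen _ hD, smul_smul] at this
  exact (N.smul_mem_iff (mul_ne_zero hc hp')).1 this

theorem eq_zero_of_mem_properWords (hC : ∀ i, σ (cartan i) m = μ i • m)
    (hm : m ∈ properWords σ m) : m = 0 := by
  -- Here `y = -m` and `N = ⊥`, so that `1 • m + y` is zero.
  have := mem_of_smul_add_mem σ m hC (neg_mem hm) ⊥ (by simp) one_ne_zero (by simp)
  simpa using this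

/-- By generation only `eₖ` and `fₖ` matter. The latter prepends a letter; the former is commuted
through the word, each commutator being zero or a Cartan element that acts on words by scalars. -/
theorem apply_mem_span_fWord (hE : ∀ k, σ (chevE k) m = 0)
    (hH : ∀ k, σ (chevH k) m = pairing k μ • m) (x : so n) :
    ∀ z ∈ Submodule.span ℂ (Set.range (fWord σ m)),
      σ x z ∈ Submodule.span ℂ (Set.range (fWord σ m)) := by
  set S := Submodule.span ℂ (Set.range (fWord σ m)) with hS
  have hword : ∀ w, fWord σ m w ∈ S := fun w => Submodule.subset_span ⟨w, rfl⟩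
  have hspan : ∀ f : Module.End ℂ M, (∀ w, f (fWord σ m w) ∈ S) → ∀ z ∈ S, f z ∈ S := by
    intro f hf
    have : S ≤ S.comap f := by
      conv_lhs => rw [hS]
      rw [Submodule.span_le]
      rintro _ ⟨w, rfl⟩
      exact hf w
    exact this
  have hC := cartan_apply_of_chevH_apply σ m hH
  have hcar : ∀ i w, σ (cartan i) (fWord σ m w) ∈ S := fun i w => by
    rw [cartan_fWord σ m hC]
    exact S.smul_mem _ (hword w)
  have hHw : ∀ k w, σ (chevH k) (fWord σ m w) ∈ S := fun k w => by
    by_cases h : (k : ℕ) + 1 < n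
    · rw [chevH_of_lt h, map_sub]
      exact S.sub_mem (hcar _ w) (hcar _ w)
    · rw [chevH_of_not_lt h, map_smul]
      exact S.smul_mem _ (hcar _ w)
  refine apply_mem_of_chevalley σ S (fun k => hspan _ fun w => ?_)
    (fun k => hspan _ fun w => hword (k :: w)) x
  induction w with
  | nil => simp [hE]
  | cons j w ih =>
    rw [fWord_cons, apply_apply_comm, lie_chevE_chevF]
    refine S.add_mem (hspan _ (fun w => hword (j :: w)) _ ih) ?_
    split_ifs
    · exact hHw k w
    · simp

theorem exists_eq_smul_add {z : M} (hz : z ∈ Submodule.span ℂ (Set.range (fWord σ m))) :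
    ∃ c : ℂ, ∃ y ∈ properWords σ m, z = c • m + y := by
  refine Submodule.span_induction ?_ ?_ ?_ ?_ hz
  · rintro _ ⟨w, rfl⟩
    by_cases hw : w = []
    · exact ⟨1, 0, zero_mem _, by simp [hw]⟩
    · exact ⟨0, fWord σ m w, Submodule.subset_span ⟨w, hw, rfl⟩, by simp⟩
  · exact ⟨0, 0, zero_mem _, by simp⟩
  · rintro _ _ _ _ ⟨c, y, hy, rfl⟩ ⟨c', y', hy', rfl⟩
    exact ⟨c + c', y + y', add_mem hy hy', by rw [add_smul]; abel⟩
  · rintro a _ _ ⟨c, y, hy, rfl⟩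
    exact ⟨a * c, a • y, Submodule.smul_mem _ _ hy, by rw [smul_add, smul_smul]⟩

end Words

/-! ### The Verma module and its proper submodules -/

section Verma

variable {n : ℕ} (μ : Weight n)

/-- The action of `𝔰𝔬(2n+1, ℂ)` on the Verma module. -/
def vermaAction : so n →ₗ⁅ℂ⁆ Module.End ℂ (Verma μ) :=
  (Algebra.lsmul ℂ ℂ (Verma μ)).toLieHom.comp (UniversalEnvelopingAlgebra.ι ℂ)

theorem vermaAction_apply (x : so n) (v : Verma μ) :
    vermaAction μ x v = UniversalEnvelopingAlgebra.ι ℂ x • v := rfl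

/-- The generator of the Verma module. -/
def vermaVec : Verma μ := (vermaIdeal μ).mkQ 1

theorem chevE_vermaVec (k : Fin n) : vermaAction μ (chevE k) (vermaVec μ) = 0 := by
  rw [vermaAction_apply, vermaVec, ← map_smul, Submodule.mkQ_apply,
    Submodule.Quotient.mk_eq_zero, smul_eq_mul, mul_one]
  exact Submodule.subset_span (Or.inl ⟨k, rfl⟩)

theorem chevH_vermaVec (k : Fin n) :
    vermaAction μ (chevH k) (vermaVec μ) = pairing k μ • vermaVec μ := by
  rw [vermaAction_apply, ← algebraMap_smul (U n) (pairing k μ) (vermaVec μ), ← sub_eq_zero,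
    ← sub_smul, vermaVec, ← map_smul, Submodule.mkQ_apply,
    Submodule.Quotient.mk_eq_zero, smul_eq_mul, mul_one]
  exact Submodule.subset_span (Or.inr ⟨k, rfl⟩)

theorem smul_mem_of_apply_mem (S : Submodule ℂ (Verma μ))
    (hS : ∀ x : so n, ∀ z ∈ S, vermaAction μ x z ∈ S) (u : U n) : ∀ z ∈ S, u • z ∈ S := by
  let B : Subalgebra ℂ (U n) :=
    { carrier := {u | ∀ z ∈ S, u • z ∈ S}
      mul_mem' := fun {a b} ha hb z hz => by rw [mul_smul]; exact ha _ (hb z hz)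
      add_mem' := fun {a b} ha hb z hz => by rw [add_smul]; exact S.add_mem (ha z hz) (hb z hz)
      algebraMap_mem' := fun c z hz => by rw [algebraMap_smul]; exact S.smul_mem c hz }
  exact mem_of_forall_ι_mem B (fun x z hz => hS x z hz) u

theorem span_fWord_vermaVec :
    Submodule.span ℂ (Set.range (fWord (vermaAction μ) (vermaVec μ))) = ⊤ := by
  rw [eq_top_iff]
  intro z _
  obtain ⟨u, rfl⟩ := Submodule.mkQ_surjective _ z
  have h : (vermaIdeal μ).mkQ u = u • vermaVec μ := by
    rw [vermaVec, ← map_smul, smul_eq_mul, mul_one]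
  rw [h]
  exact smul_mem_of_apply_mem μ _
    (apply_mem_span_fWord _ _ (chevE_vermaVec μ) (chevH_vermaVec μ)) u _
    (Submodule.subset_span ⟨[], rfl⟩)

theorem eq_top_of_vermaVec_mem (N : Submodule (U n) (Verma μ)) (h : vermaVec μ ∈ N) : N = ⊤ := by
  rw [eq_top_iff]
  intro z _
  obtain ⟨u, rfl⟩ := Submodule.mkQ_surjective _ z
  have h' : (vermaIdeal μ).mkQ u = u • vermaVec μ := by
    rw [vermaVec, ← map_smul, smul_eq_mul, mul_one]
  exact h' ▸ N.smul_mem u h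

/-- A nonzero component along the generator would put the generator itself into `N`, and then `N`
would be everything. -/
theorem le_properWords (N : Submodule (U n) (Verma μ)) (hN : N ≠ ⊤) {z : Verma μ} (hz : z ∈ N) :
    z ∈ properWords (vermaAction μ) (vermaVec μ) := by
  obtain ⟨c, y, hy, rfl⟩ := exists_eq_smul_add (vermaAction μ) (vermaVec μ) (z := z)
    (by rw [span_fWord_vermaVec]; trivial)
  by_cases hc : c = 0
  · simpa [hc] using hy
  refine absurd (eq_top_of_vermaVec_mem μ N ?_) hN
  exact mem_of_smul_add_mem (vermaAction μ) (vermaVec μ)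
    (cartan_apply_of_chevH_apply _ _ (chevH_vermaVec μ)) hy (N.restrictScalars ℂ)
    (fun x z hz => N.smul_mem _ hz) hc hz

end Verma

/-- An irreducible representation with a highest weight vector of weight `μ` is isomorphic
to `V(μ)`. -/
theorem repIso_irrepAction {n : ℕ} {V : Type*} [AddCommGroup V] [Module ℂ V]
    (ρ : so n →ₗ⁅ℂ⁆ Module.End ℂ V) (μ : Weight n) (v : V) (hρ : IsIrreducibleRep ρ)
    (hv : IsHighestWeightVector ρ μ v) : RepIso ρ (irrepAction μ) := by
  obtain ⟨hv0, hE, hH⟩ := hv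
  let A : U n →ₐ[ℂ] Module.End ℂ V := UniversalEnvelopingAlgebra.lift ℂ ρ
  let : Module (U n) V := Module.compHom V A.toRingHom
  have smul_def : ∀ (u : U n) (x : V), u • x = A u x := fun _ _ => rfl
  have hι : ∀ (x : so n) (z : V), UniversalEnvelopingAlgebra.ι ℂ x • z = ρ x z := by
    intro x z
    rw [smul_def]
    simp [A]
  have halg : ∀ (c : ℂ) (z : V), algebraMap ℂ (U n) c • z = c • z := by
    intro c z
    rw [smul_def, AlgHom.commutes, Module.algebraMap_end_apply]
  have : IsScalarTower ℂ (U n) V := by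
    refine ⟨fun c u z => ?_⟩
    rw [Algebra.smul_def, mul_smul, halg]
  let φ₀ : U n →ₗ[U n] V := LinearMap.toSpanSingleton (U n) V v
  have hφ₀ : ∀ u, φ₀ u = u • v := fun u => rfl
  have hker : vermaIdeal μ ≤ LinearMap.ker φ₀ := by
    refine Submodule.span_le.2 ?_
    rintro _ (⟨k, rfl⟩ | ⟨k, rfl⟩)
    · simp only [SetLike.mem_coe, LinearMap.mem_ker, hφ₀, hι, hE]
    · simp only [SetLike.mem_coe, LinearMap.mem_ker, hφ₀, sub_smul, hι, halg, hH, sub_self]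
  let φ : Verma μ →ₗ[U n] V := (vermaIdeal μ).liftQ φ₀ hker
  have hφv : φ (vermaVec μ) = v := by
    simp [φ, vermaVec, hφ₀]
  have hφc : ∀ (c : ℂ) z, φ (c • z) = c • φ z := fun c z => by
    rw [← algebraMap_smul (U n) c z, map_smul, halg]
  have hφx : ∀ x z, φ (vermaAction μ x z) = ρ x (φ z) := fun x z => by
    rw [vermaAction_apply, map_smul, hι]
  have hφw : ∀ w, φ (fWord (vermaAction μ) (vermaVec μ) w) = fWord ρ v w := by
    intro w
    induction w with
    | nil => exact hφv
    | cons k w ih => rw [fWord_cons, hφx, ih, fWord_cons]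
  let φℂ : Verma μ →ₗ[ℂ] V := { toFun := φ, map_add' := map_add φ, map_smul' := hφc }
  have hφproper : ∀ z ∈ properWords (vermaAction μ) (vermaVec μ), φ z ∈ properWords ρ v := by
    have : properWords (vermaAction μ) (vermaVec μ) ≤ (properWords ρ v).comap φℂ := by
      refine Submodule.span_le.2 ?_
      rintro _ ⟨w, hw, rfl⟩
      exact Submodule.subset_span ⟨w, hw, (hφw w).symm⟩
    exact this
  -- Images of submodules are invariant, so irreducibility leaves two cases.
  have himage : ∀ N : Submodule (U n) (Verma μ),
      (N.restrictScalars ℂ).map φℂ = ⊥ ∨ (N.restrictScalars ℂ).map φℂ = ⊤ := by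
    intro N
    refine hρ.2 _ ?_
    rintro x _ ⟨z, hz, rfl⟩
    exact ⟨vermaAction μ x z, N.smul_mem _ hz, hφx x z⟩
  -- A proper `N` with full image would contain a preimage of `v` made of nonempty words; then `v`
  -- would be a combination of nonempty words applied to itself, hence zero. Conversely the kernel
  -- is one of the proper submodules, since the generator goes to `v ≠ 0`.
  have hrad : vermaRadical μ = LinearMap.ker φ := by
    refine le_antisymm (sSup_le fun N hN => ?_) (le_sSup fun h => hv0 ?_)
    · rcases himage N with h | h
      · intro z hz
        have : φℂ z ∈ (N.restrictScalars ℂ).map φℂ := ⟨z, hz, rfl⟩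
        rw [h] at this
        exact this
      · have : v ∈ (N.restrictScalars ℂ).map φℂ := h ▸ Submodule.mem_top
        obtain ⟨z, hz, hzv⟩ := this
        have h1 := hφproper z (le_properWords μ N hN hz)
        rw [show φ z = v from hzv] at h1
        exact absurd (eq_zero_of_mem_properWords ρ v (cartan_apply_of_chevH_apply _ _ hH) h1) hv0
    · rw [← hφv, ← LinearMap.mem_ker, h]
      trivial
  have hsurj : Function.Surjective φ := by
    rcases himage ⊤ with h | h
    · have : φℂ (vermaVec μ) ∈ ((⊤ : Submodule (U n) (Verma μ)).restrictScalars ℂ).map φℂ :=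
        ⟨_, trivial, rfl⟩
      rw [h] at this
      exact absurd (hφv.symm.trans this) hv0
    · intro z
      have : z ∈ ((⊤ : Submodule (U n) (Verma μ)).restrictScalars ℂ).map φℂ := h ▸ Submodule.mem_top
      obtain ⟨y, -, hy⟩ := this
      exact ⟨y, hy⟩
  let e : Irrep μ ≃ₗ[U n] V :=
    (Submodule.quotEquivOfEq _ _ hrad).trans (φ.quotKerEquivOfSurjective hsurj)
  refine ⟨(e.restrictScalars ℂ).symm, fun x z => ?_⟩
  rw [irrepAction_apply, ← hι]
  exact e.symm.map_smul _ _

/-! ## The representation attached to operators satisfying the Clifford relations -/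

section Clifford

variable {n : ℕ} {R : Type*} [Ring R] [Algebra ℂ R] (γ : Idx n → R)

/-- The quadratic element `½ ∑ M a b γ a γ b`. -/
def quadratic : Matrix (Idx n) (Idx n) ℂ →ₗ[ℂ] R where
  toFun M := ∑ a, ∑ b, ((1 / 2 : ℂ) * M a b) • (γ a * γ b)
  map_add' M N := by
    simp only [Matrix.add_apply, mul_add, add_smul, Finset.sum_add_distrib]
  map_smul' c M := by
    simp only [Matrix.smul_apply, smul_eq_mul, Finset.smul_sum, smul_smul, RingHom.id_apply]
    refine Finset.sum_congr rfl fun a _ => Finset.sum_congr rfl fun b _ => ?_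
    congr 1
    ring

theorem quadratic_apply (M : Matrix (Idx n) (Idx n) ℂ) :
    quadratic γ M = ∑ a, ∑ b, ((1 / 2 : ℂ) * M a b) • (γ a * γ b) := rfl

theorem quadratic_single (a b : Idx n) :
    quadratic γ (single a b 1) = (1 / 2 : ℂ) • (γ a * γ b) := by
  rw [quadratic_apply, Finset.sum_eq_single a, Finset.sum_eq_single b]
  · simp
  · intro c _ hc; simp [hc.symm]
  · simp
  · intro c _ hc; simp [hc.symm]
  · simp

/-- Left multiplication by `A` transforms the first factor of every product `γ c * γ d`;
`quadratic_mul_transpose` does the same for the second. Together they express the derivation action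
on quadratic elements. -/
theorem quadratic_mul (A N : Matrix (Idx n) (Idx n) ℂ) :
    quadratic γ (A * N) = ∑ c, ∑ d, ((1 / 2 : ℂ) * N c d) • ((∑ a, A a c • γ a) * γ d) := by
  simp only [quadratic_apply, Matrix.mul_apply, Finset.mul_sum, Finset.sum_smul, Finset.sum_mul,
    Finset.smul_sum, smul_mul_assoc, smul_smul]
  rw [Finset.sum_comm, Finset.sum_comm (s := Finset.univ (α := Idx n)) (t := Finset.univ)
    (f := fun c d => ∑ a, ((1 / 2 : ℂ) * N c d * A a c) • (γ a * γ d))]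
  refine Finset.sum_congr rfl fun d _ => ?_
  rw [Finset.sum_comm]
  refine Finset.sum_congr rfl fun c _ => Finset.sum_congr rfl fun a _ => ?_
  congr 1
  ring

theorem quadratic_mul_transpose (A N : Matrix (Idx n) (Idx n) ℂ) :
    quadratic γ (N * Aᵀ) = ∑ c, ∑ d, ((1 / 2 : ℂ) * N c d) • (γ c * ∑ a, A a d • γ a) := by
  simp only [quadratic_apply, Matrix.mul_apply, Finset.mul_sum, Finset.sum_smul,
    Finset.smul_sum, mul_smul_comm, smul_smul, transpose_apply]
  refine Finset.sum_congr rfl fun c _ => ?_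
  rw [Finset.sum_comm]
  refine Finset.sum_congr rfl fun d _ => Finset.sum_congr rfl fun a _ => ?_
  congr 1
  ring

variable {γ}

/-- Moving `γ c` through `γ a * γ b` by two anticommutators leaves two linear terms; skewness of `M`
makes their totals equal, which absorbs the factor ½. -/
theorem lie_quadratic_gen
    (hγ : ∀ a b, γ a * γ b + γ b * γ a = algebraMap ℂ R (gram n a b))
    {M : Matrix (Idx n) (Idx n) ℂ} (hM : Mᵀ = -M) (c : Idx n) :
    ⁅quadratic γ M, γ c⁆ = ∑ a, (M * gram n) a c • γ a := by
  have h3 : ∀ a b, ⁅γ a * γ b, γ c⁆ = gram n b c • γ a - gram n a c • γ b := by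
    intro a b
    have h1 : γ b * γ c = algebraMap ℂ R (gram n b c) - γ c * γ b := by rw [← hγ]; abel
    have h2 : γ c * γ a = algebraMap ℂ R (gram n a c) - γ a * γ c := by rw [← hγ]; abel
    rw [LieRing.of_associative_ring_bracket, mul_assoc, h1, ← mul_assoc, h2, mul_sub, sub_mul,
      Algebra.smul_def, Algebra.smul_def, ← Algebra.commutes, mul_assoc]
    abel
  have h4 : ⁅quadratic γ M, γ c⁆ = ∑ a, ∑ b, ((1 / 2 : ℂ) * M a b) • ⁅γ a * γ b, γ c⁆ := by
    simp only [quadratic_apply, LieRing.of_associative_ring_bracket, Finset.sum_mul,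
      Finset.mul_sum, smul_sub, Finset.sum_sub_distrib, smul_mul_assoc, mul_smul_comm]
  rw [h4]
  simp only [h3, smul_sub, Finset.sum_sub_distrib]
  rw [Finset.sum_comm (f := fun a b => ((1 / 2 : ℂ) * M a b) • gram n a c • γ b),
    ← Finset.sum_sub_distrib]
  refine Finset.sum_congr rfl fun a _ => ?_
  rw [← Finset.sum_sub_distrib, Matrix.mul_apply, Finset.sum_smul]
  refine Finset.sum_congr rfl fun b _ => ?_
  have hab : M b a = -M a b := congrFun₂ hM a b
  rw [hab, smul_smul, smul_smul, ← sub_smul]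
  congr 1
  ring

theorem lie_quadratic_quadratic
    (hγ : ∀ a b, γ a * γ b + γ b * γ a = algebraMap ℂ R (gram n a b))
    {M : Matrix (Idx n) (Idx n) ℂ} (hM : Mᵀ = -M)
    (N : Matrix (Idx n) (Idx n) ℂ) :
    ⁅quadratic γ M, quadratic γ N⁆ =
      quadratic γ (M * gram n * N) + quadratic γ (N * (M * gram n)ᵀ) := by
  rw [quadratic_mul, quadratic_mul_transpose]
  simp only [← lie_quadratic_gen hγ hM]
  rw [← Finset.sum_add_distrib, quadratic_apply γ N, LieRing.of_associative_ring_bracket,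
    Finset.mul_sum, Finset.sum_mul, ← Finset.sum_sub_distrib]
  refine Finset.sum_congr rfl fun c _ => ?_
  rw [← Finset.sum_add_distrib, Finset.mul_sum, Finset.sum_mul, ← Finset.sum_sub_distrib]
  refine Finset.sum_congr rfl fun d _ => ?_
  simp only [LieRing.of_associative_ring_bracket, ← smul_add, smul_mul_assoc, mul_smul_comm,
    ← smul_sub]
  congr 1
  noncomm_ring

/-- The Lie algebra homomorphism attached to elements satisfying the Clifford relations. -/
def cliffordHom (hγ : ∀ a b, γ a * γ b + γ b * γ a = algebraMap ℂ R (gram n a b)) :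
    so n →ₗ⁅ℂ⁆ R where
  toFun A := quadratic γ (A.1 * gramInv n)
  map_add' A B := by rw [← map_add, ← Matrix.add_mul]; rfl
  map_smul' c A := by rw [RingHom.id_apply, ← map_smul, ← Matrix.smul_mul]; rfl
  map_lie' {A B} := by
    have hM : (A.1 * gramInv n)ᵀ = -(A.1 * gramInv n) := by
      rw [transpose_mul, gramInv_transpose, gramInv_mul_transpose]
    -- With `M = A * gramInv n` one has `M * gram n = A`, and `gramInv n * Aᵀ = -(A * gramInv n)`;
    -- the two terms combine into the commutator of `A` and `B`.
    rw [lie_quadratic_quadratic hγ hM, ← map_add, Matrix.mul_assoc A.1 (gramInv n),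
      gramInv_mul_gram, Matrix.mul_one, Matrix.mul_assoc B.1, gramInv_mul_transpose]
    congr 1
    change (A.1 * B.1 - B.1 * A.1) * gramInv n = _
    rw [Matrix.sub_mul, Matrix.mul_neg, Matrix.mul_assoc, Matrix.mul_assoc, sub_eq_add_neg]

theorem cliffordHom_wedge
    (hγ : ∀ a b, γ a * γ b + γ b * γ a = algebraMap ℂ R (gram n a b))
    (a b : Idx n) :
    cliffordHom hγ (wedge (stdVec a) (stdVec b)) = (1 / 2 : ℂ) • (γ a * γ b - γ b * γ a) := by
  change quadratic γ ((wedge (stdVec a) (stdVec b)).1 * gramInv n) = _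
  rw [wedge_stdVec, Matrix.mul_assoc, gram_mul_gramInv, Matrix.mul_one, map_sub, quadratic_single,
    quadratic_single, smul_sub]

theorem cliffordHom_wedge_of_gram_eq_zero
    (hγ : ∀ a b, γ a * γ b + γ b * γ a = algebraMap ℂ R (gram n a b))
    {a b : Idx n} (h : gram n a b = 0) :
    cliffordHom hγ (wedge (stdVec a) (stdVec b)) = γ a * γ b := by
  have h' : γ b * γ a = -(γ a * γ b) := by
    rw [eq_neg_iff_add_eq_zero, add_comm, hγ, h, map_zero]
  rw [cliffordHom_wedge, h', sub_neg_eq_add, ← two_smul ℂ, smul_smul]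
  norm_num

end Clifford

/-! ## Fermionic operators -/

section Fermion

variable {n : ℕ}

/-- The space with basis the subsets of `{1, …, n}`. -/
abbrev Fock (n : ℕ) := Finset (Fin n) →₀ ℂ

/-- The sign `(-1)^{#{j < m | j ∉ S}}`. -/
def stringSign (m : ℕ) (S : Finset (Fin n)) : ℂ :=
  ∏ j : Fin n, if (j : ℕ) < m ∧ j ∉ S then -1 else 1

theorem stringSign_insert (m : ℕ) {S : Finset (Fin n)} {i : Fin n} (hi : i ∉ S) :
    stringSign m (insert i S) = if (i : ℕ) < m then -stringSign m S else stringSign m S := by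
  unfold stringSign
  rw [← Finset.mul_prod_erase _ _ (Finset.mem_univ i),
    ← Finset.mul_prod_erase _ (fun j : Fin n => if (j : ℕ) < m ∧ j ∉ S then (-1 : ℂ) else 1)
      (Finset.mem_univ i)]
  have : ∏ x ∈ Finset.univ.erase i, (if (x : ℕ) < m ∧ x ∉ insert i S then (-1 : ℂ) else 1) =
      ∏ x ∈ Finset.univ.erase i, (if (x : ℕ) < m ∧ x ∉ S then (-1 : ℂ) else 1) := by
    refine Finset.prod_congr rfl fun x hx => ?_
    simp [Finset.ne_of_mem_erase hx]
  rw [this]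
  split_ifs with h <;> simp_all

theorem stringSign_erase (m : ℕ) {S : Finset (Fin n)} {i : Fin n} (hi : i ∈ S) :
    stringSign m (S.erase i) = if (i : ℕ) < m then -stringSign m S else stringSign m S := by
  have := stringSign_insert m (Finset.notMem_erase i S)
  rw [Finset.insert_erase hi] at this
  split_ifs at this ⊢ <;> simp [this]

theorem stringSign_mul_self (m : ℕ) (S : Finset (Fin n)) :
    stringSign m S * stringSign m S = 1 := by
  unfold stringSign
  rw [← Finset.prod_mul_distrib]
  refine Finset.prod_eq_one fun j _ => ?_
  split_ifs <;> norm_num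

/-- The sign counts absent elements, so a present `i` contributes nothing. This is what makes the
Chevalley generators act without signs. -/
theorem stringSign_succ {i : Fin n} {S : Finset (Fin n)} (hi : i ∈ S) :
    stringSign (i + 1) S = stringSign i S := by
  unfold stringSign
  refine Finset.prod_congr rfl fun j _ => ?_
  by_cases hj : j = i
  · simp [hj, hi]
  · have : (j : ℕ) ≠ i := fun h => hj (Fin.ext h)
    have h : (j : ℕ) < i + 1 ↔ (j : ℕ) < i := by omega
    simp [h]

/-- The operator removing `i` from a subset, with a sign. -/
def annihilate (i : Fin n) : Module.End ℂ (Fock n) :=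
  Finsupp.linearCombination ℂ
    fun S => if i ∈ S then stringSign i S • Finsupp.single (S.erase i) 1 else 0

/-- The operator adding `i` to a subset, with a sign. -/
def create (i : Fin n) : Module.End ℂ (Fock n) :=
  Finsupp.linearCombination ℂ
    fun S => if i ∈ S then 0 else stringSign i S • Finsupp.single (insert i S) 1

/-- The parity operator. -/
def parity (n : ℕ) : Module.End ℂ (Fock n) :=
  Finsupp.linearCombination ℂ fun S => stringSign n S • Finsupp.single S 1

theorem annihilate_of_mem {i : Fin n} {S : Finset (Fin n)} (h : i ∈ S) :
    annihilate i (Finsupp.single S 1) = stringSign i S • Finsupp.single (S.erase i) 1 := by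
  simp [annihilate, h]

theorem annihilate_of_notMem {i : Fin n} {S : Finset (Fin n)} (h : i ∉ S) :
    annihilate i (Finsupp.single S 1) = 0 := by
  simp [annihilate, h]

theorem create_of_mem {i : Fin n} {S : Finset (Fin n)} (h : i ∈ S) :
    create i (Finsupp.single S 1) = 0 := by
  simp [create, h]

theorem create_of_notMem {i : Fin n} {S : Finset (Fin n)} (h : i ∉ S) :
    create i (Finsupp.single S 1) = stringSign i S • Finsupp.single (insert i S) 1 := by
  simp [create, h]

theorem parity_single (S : Finset (Fin n)) :
    parity n (Finsupp.single S 1) = stringSign n S • Finsupp.single S 1 := by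
  simp [parity]

theorem end_ext {ι : Type*} {f g : Module.End ℂ (ι →₀ ℂ)}
    (h : ∀ S, f (Finsupp.single S 1) = g (Finsupp.single S 1)) : f = g := by
  refine Finsupp.lhom_ext' fun S => LinearMap.ext_ring ?_
  simpa using h S

theorem annihilate_annihilate (i j : Fin n) :
    annihilate i * annihilate j + annihilate j * annihilate i = 0 := by
  refine end_ext fun S => ?_
  simp only [LinearMap.add_apply, Module.End.mul_apply, LinearMap.zero_apply]
  by_cases hij : i = j
  · subst hij
    by_cases hi : i ∈ S
    · simp [-Finsupp.smul_single, annihilate_of_mem hi, annihilate_of_notMem]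
    · simp [-Finsupp.smul_single, annihilate_of_notMem hi]
  by_cases hi : i ∈ S <;> by_cases hj : j ∈ S
  · have hi' : i ∈ S.erase j := Finset.mem_erase.2 ⟨hij, hi⟩
    have hj' : j ∈ S.erase i := Finset.mem_erase.2 ⟨Ne.symm hij, hj⟩
    rw [annihilate_of_mem hi, annihilate_of_mem hj, map_smul, map_smul, annihilate_of_mem hi',
      annihilate_of_mem hj', stringSign_erase _ hi, stringSign_erase _ hj,
      Finset.erase_right_comm, smul_smul, smul_smul, ← add_smul]
    -- Removing the smaller index first flips the sign string of the larger one; the opposite order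
    -- changes neither string. The two orders therefore cancel.
    rcases lt_or_gt_of_ne (fun h => hij (Fin.ext h) : (i : ℕ) ≠ j) with h | h
    · rw [if_pos h, if_neg h.le.not_gt]; convert zero_smul ℂ _; ring
    · rw [if_pos h, if_neg h.le.not_gt]; convert zero_smul ℂ _; ring
  · have hj' : j ∉ S.erase i := fun h => hj (Finset.mem_of_mem_erase h)
    simp [-Finsupp.smul_single, annihilate_of_mem hi, annihilate_of_notMem hj, annihilate_of_notMem hj']
  · have hi' : i ∉ S.erase j := fun h => hi (Finset.mem_of_mem_erase h)
    simp [-Finsupp.smul_single, annihilate_of_mem hj, annihilate_of_notMem hi, annihilate_of_notMem hi']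
  · simp [-Finsupp.smul_single, annihilate_of_notMem hj, annihilate_of_notMem hi]

theorem create_create (i j : Fin n) :
    create i * create j + create j * create i = 0 := by
  refine end_ext fun S => ?_
  simp only [LinearMap.add_apply, Module.End.mul_apply, LinearMap.zero_apply]
  by_cases hij : i = j
  · subst hij
    by_cases hi : i ∈ S
    · simp [-Finsupp.smul_single, create_of_mem hi]
    · simp [-Finsupp.smul_single, create_of_notMem hi, create_of_mem]
  by_cases hi : i ∈ S <;> by_cases hj : j ∈ S
  · simp [-Finsupp.smul_single, create_of_mem hi, create_of_mem hj]
  · simp [-Finsupp.smul_single, create_of_mem hi, create_of_notMem hj, create_of_mem (Finset.mem_insert_of_mem hi)]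
  · simp [-Finsupp.smul_single, create_of_mem hj, create_of_notMem hi, create_of_mem (Finset.mem_insert_of_mem hj)]
  · have hi' : i ∉ insert j S := by simp [hij, hi]
    have hj' : j ∉ insert i S := by simp [Ne.symm hij, hj]
    rw [create_of_notMem hi, create_of_notMem hj, map_smul, map_smul, create_of_notMem hi',
      create_of_notMem hj', stringSign_insert _ hi, stringSign_insert _ hj,
      Finset.insert_comm, smul_smul, smul_smul, ← add_smul]
    rcases lt_or_gt_of_ne (fun h => hij (Fin.ext h) : (i : ℕ) ≠ j) with h | h
    · rw [if_pos h, if_neg h.le.not_gt]; convert zero_smul ℂ _; ring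
    · rw [if_pos h, if_neg h.le.not_gt]; convert zero_smul ℂ _; ring

theorem annihilate_create (i j : Fin n) :
    annihilate i * create j + create j * annihilate i = if i = j then 1 else 0 := by
  refine end_ext fun S => ?_
  simp only [LinearMap.add_apply, Module.End.mul_apply]
  by_cases hij : i = j
  · subst hij
    rw [if_pos rfl, Module.End.one_apply]
    by_cases hi : i ∈ S
    · rw [create_of_mem hi, annihilate_of_mem hi, map_smul,
        create_of_notMem (Finset.notMem_erase i S), stringSign_erase _ hi, if_neg (lt_irrefl _),
        Finset.insert_erase hi, smul_smul, stringSign_mul_self]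
      simp
    · rw [create_of_notMem hi, annihilate_of_notMem hi, map_smul,
        annihilate_of_mem (Finset.mem_insert_self i S), stringSign_insert _ hi,
        if_neg (lt_irrefl _), Finset.erase_insert hi, smul_smul, stringSign_mul_self]
      simp
  rw [if_neg hij, LinearMap.zero_apply]
  by_cases hi : i ∈ S <;> by_cases hj : j ∈ S
  · have hj' : j ∈ S.erase i := Finset.mem_erase.2 ⟨Ne.symm hij, hj⟩
    simp [-Finsupp.smul_single, create_of_mem hj, annihilate_of_mem hi, create_of_mem hj']
  · have hi' : i ∈ insert j S := Finset.mem_insert_of_mem hi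
    have hj' : j ∉ S.erase i := fun h => hj (Finset.mem_of_mem_erase h)
    rw [create_of_notMem hj, annihilate_of_mem hi, map_smul, map_smul, annihilate_of_mem hi',
      create_of_notMem hj', stringSign_insert _ hj, stringSign_erase _ hi,
      Finset.erase_insert_of_ne (Ne.symm hij), smul_smul, smul_smul, ← add_smul]
    rcases lt_or_gt_of_ne (fun h => hij (Fin.ext h) : (i : ℕ) ≠ j) with h | h
    · rw [if_pos h, if_neg h.le.not_gt]; convert zero_smul ℂ _; ring
    · rw [if_pos h, if_neg h.le.not_gt]; convert zero_smul ℂ _; ring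
  · simp [-Finsupp.smul_single, create_of_mem hj, annihilate_of_notMem hi]
  · have hi' : i ∉ insert j S := by simp [hij, hi]
    simp [-Finsupp.smul_single, create_of_notMem hj, annihilate_of_notMem hi, annihilate_of_notMem hi']

theorem parity_annihilate (i : Fin n) :
    parity n * annihilate i + annihilate i * parity n = 0 := by
  refine end_ext fun S => ?_
  simp only [LinearMap.add_apply, Module.End.mul_apply, LinearMap.zero_apply, parity_single,
    map_smul]
  by_cases hi : i ∈ S
  · rw [annihilate_of_mem hi, map_smul, parity_single, stringSign_erase _ hi, if_pos i.2,
      smul_smul, smul_smul, ← add_smul]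
    convert zero_smul ℂ _; ring
  · simp [-Finsupp.smul_single, annihilate_of_notMem hi]

theorem parity_create (i : Fin n) :
    parity n * create i + create i * parity n = 0 := by
  refine end_ext fun S => ?_
  simp only [LinearMap.add_apply, Module.End.mul_apply, LinearMap.zero_apply, parity_single,
    map_smul]
  by_cases hi : i ∈ S
  · simp [-Finsupp.smul_single, create_of_mem hi]
  · rw [create_of_notMem hi, map_smul, parity_single, stringSign_insert _ hi, if_pos i.2,
      smul_smul, smul_smul, ← add_smul]
    convert zero_smul ℂ _; ring

theorem parity_parity : parity n * parity n = 1 := by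
  refine end_ext fun S => ?_
  simp [-Finsupp.smul_single, parity_single, smul_smul, stringSign_mul_self]

/-- The operators on the Fock space satisfying the Clifford relations. -/
def fermion : Idx n → Module.End ℂ (Fock n)
  | Sum.inl _ => parity n
  | Sum.inr (Sum.inl i) => annihilate i
  | Sum.inr (Sum.inr i) => create i

/-- Parity squares to one, so its anticommutator with itself is 2, matching the normalisation of the
form at `u₀`. -/
theorem fermion_anticomm (a b : Idx n) : fermion a * fermion b + fermion b * fermion a =
    algebraMap ℂ (Module.End ℂ (Fock n)) (gram n a b) := by
  rcases a with a | a | a <;> rcases b with b | b | b <;> simp only [fermion]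
  · rw [parity_parity, gram_u0_u0, map_ofNat, one_add_one_eq_two]
  · rw [parity_annihilate, gram_u0_inr, map_zero]
  · rw [parity_create, gram_u0_inr, map_zero]
  · rw [add_comm, parity_annihilate, gram_inr_u0, map_zero]
  · rw [annihilate_annihilate, gram_v_v, map_zero]
  · rw [annihilate_create, gram_v_w, apply_ite (algebraMap ℂ _), map_one, map_zero]
  · rw [add_comm, parity_create, gram_inr_u0, map_zero]
  · rw [add_comm, annihilate_create, gram_w_v, apply_ite (algebraMap ℂ _), map_one, map_zero]
    simp only [eq_comm]
  · rw [create_create, gram_w_w, map_zero]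

/-- The spin representation on the Fock space. -/
def fockRep (n : ℕ) : so n →ₗ⁅ℂ⁆ Module.End ℂ (Fock n) := cliffordHom fermion_anticomm

/-- The strings at `k + 1` and at `k` agree because `k` is present, and inserting `k + 1` does not
affect the string at `k`; the two signs multiply to one. -/
theorem fockRep_chevE_of_lt {k : Fin n} (h : (k : ℕ) + 1 < n) (S : Finset (Fin n)) :
    fockRep n (chevE k) (Finsupp.single S 1) =
      if k ∈ S ∧ ⟨k + 1, h⟩ ∉ S then
        Finsupp.single ((insert ⟨k + 1, h⟩ S).erase k) 1 else 0 := by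
  rw [chevE_of_lt h, fockRep, cliffordHom_wedge_of_gram_eq_zero _ (by simp [Fin.ext_iff])]
  simp only [fermion, Module.End.mul_apply]
  by_cases h2 : (⟨k + 1, h⟩ : Fin n) ∈ S
  · simp [create_of_mem h2, h2]
  by_cases h1 : k ∈ S
  · rw [create_of_notMem h2, map_smul, annihilate_of_mem (Finset.mem_insert_of_mem h1),
      stringSign_insert _ h2, if_neg (by simp), smul_smul, if_pos ⟨h1, h2⟩,
      stringSign_succ h1, stringSign_mul_self, one_smul]
  · rw [create_of_notMem h2, map_smul, annihilate_of_notMem (by simp [h1, Fin.ext_iff])]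
    simp [h1]

theorem fockRep_chevF_of_lt {k : Fin n} (h : (k : ℕ) + 1 < n) (S : Finset (Fin n)) :
    fockRep n (chevF k) (Finsupp.single S 1) =
      if k ∉ S ∧ ⟨k + 1, h⟩ ∈ S then
        Finsupp.single ((insert k S).erase ⟨k + 1, h⟩) 1 else 0 := by
  rw [chevF_of_lt h, fockRep, cliffordHom_wedge_of_gram_eq_zero _ (by simp [Fin.ext_iff])]
  simp only [fermion, Module.End.mul_apply]
  by_cases h1 : k ∈ S
  · simp [create_of_mem h1, h1]
  by_cases h2 : (⟨k + 1, h⟩ : Fin n) ∈ S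
  · rw [create_of_notMem h1, map_smul, annihilate_of_mem (Finset.mem_insert_of_mem h2), smul_smul,
      if_pos ⟨h1, h2⟩]
    have hs : stringSign ((⟨k + 1, h⟩ : Fin n) : ℕ) (insert k S) = stringSign k S := by
      rw [show ((⟨k + 1, h⟩ : Fin n) : ℕ) = k + 1 from rfl,
        stringSign_succ (Finset.mem_insert_self k S), stringSign_insert _ h1,
        if_neg (lt_irrefl _)]
    rw [hs, stringSign_mul_self, one_smul]
  · rw [create_of_notMem h1, map_smul, annihilate_of_notMem (by simp [h2, Fin.ext_iff])]
    simp [h2]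

theorem stringSign_last {k : Fin n} (h : ¬ (k : ℕ) + 1 < n) {S : Finset (Fin n)} (hk : k ∈ S) :
    stringSign n S = stringSign k S := by
  rw [← stringSign_succ hk]
  congr 1
  omega

/-- The parity sign equals the string of the last index when that index is present, so it cancels
the sign of the removal. -/
theorem fockRep_chevE_of_not_lt {k : Fin n} (h : ¬ (k : ℕ) + 1 < n) (S : Finset (Fin n)) :
    fockRep n (chevE k) (Finsupp.single S 1) =
      if k ∈ S then Finsupp.single (S.erase k) 1 else 0 := by
  rw [chevE_of_not_lt h, fockRep, cliffordHom_wedge_of_gram_eq_zero _ (by simp)]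
  simp only [fermion, Module.End.mul_apply, parity_single, map_smul]
  by_cases h1 : k ∈ S
  · rw [annihilate_of_mem h1, smul_smul, stringSign_last h h1, stringSign_mul_self, one_smul,
      if_pos h1]
  · simp [annihilate_of_notMem h1, h1]

theorem fockRep_chevF_of_not_lt {k : Fin n} (h : ¬ (k : ℕ) + 1 < n) (S : Finset (Fin n)) :
    fockRep n (chevF k) (Finsupp.single S 1) =
      if k ∉ S then Finsupp.single (insert k S) 1 else 0 := by
  rw [chevF_of_not_lt h, fockRep, cliffordHom_wedge_of_gram_eq_zero _ (by simp)]
  simp only [fermion, Module.End.mul_apply]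
  by_cases h1 : k ∈ S
  · simp [create_of_mem h1, h1]
  · rw [create_of_notMem h1, map_smul, parity_single, stringSign_last h (Finset.mem_insert_self k S),
      stringSign_insert _ h1, if_neg (lt_irrefl _), smul_smul, stringSign_mul_self, one_smul,
      if_pos h1]

/-- Of the two orders of removing and inserting `i`, exactly one is nonzero on a given subset, and
it acts as the identity there; antisymmetrising gives `±1/2`. -/
theorem fockRep_cartan (i : Fin n) (S : Finset (Fin n)) :
    fockRep n (cartan i) (Finsupp.single S 1) =
      ((1 / 2 : ℂ) - if i ∈ S then 1 else 0) • Finsupp.single S 1 := by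
  rw [cartan, fockRep, cliffordHom_wedge]
  simp only [fermion, LinearMap.smul_apply, LinearMap.sub_apply, Module.End.mul_apply]
  by_cases hi : i ∈ S
  · rw [create_of_mem hi, annihilate_of_mem hi, map_smul,
      create_of_notMem (Finset.notMem_erase i S), stringSign_erase _ hi, if_neg (lt_irrefl _),
      Finset.insert_erase hi, smul_smul, stringSign_mul_self, if_pos hi, map_zero, zero_sub,
      one_smul, smul_neg, ← neg_smul]
    norm_num
  · rw [create_of_notMem hi, annihilate_of_notMem hi, map_smul,
      annihilate_of_mem (Finset.mem_insert_self i S), stringSign_insert _ hi,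
      if_neg (lt_irrefl _), Finset.erase_insert hi, smul_smul, stringSign_mul_self, if_neg hi]
    simp

end Fermion

/-! ## Self-conjugate diagrams and subsets -/

section Diagrams

variable {n : ℕ}

/-- The number of vertices of degree `d`. -/
def degCount (n : ℕ) (Y : YoungDiagram) (d : ℕ) : ℕ :=
  (Y.cells.filter (fun c => degree n c = d)).card

theorem eq_range_card {T : Finset ℕ} (hT : ∀ s t, s ≤ t → t ∈ T → s ∈ T) :
    T = Finset.range T.card := by
  ext t
  rw [Finset.mem_range]
  constructor
  · intro ht
    have h : Finset.range (t + 1) ⊆ T := fun s hs =>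
      hT s t (Nat.lt_succ_iff.1 (Finset.mem_range.1 hs)) ht
    simpa using Finset.card_le_card h
  · intro ht
    by_contra h
    have : T ⊆ Finset.range t := fun s hs => by
      rw [Finset.mem_range]
      by_contra hst
      exact h (hT t s (not_lt.1 hst) hs)
    have := Finset.card_le_card this
    rw [Finset.card_range] at this
    omega

/-- For `d ≤ n` the vertices of degree `d` lie on the diagonal `(n - d + t, t)`. Closure under going
up and left makes the occupied `t` an initial segment, whose length is the count. -/
theorem mem_iff_lt_degCount {Y : YoungDiagram} (hY : InBox n Y) {d t : ℕ} (hd : d ≤ n) :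
    (n - d + t, t) ∈ Y ↔ t < degCount n Y d := by
  classical
  set T := (Finset.range n).filter (fun t => (n - d + t, t) ∈ Y) with hT
  have hmem : ∀ t, t ∈ T ↔ (n - d + t, t) ∈ Y := fun t => by
    rw [hT, Finset.mem_filter, Finset.mem_range]
    exact ⟨fun h => h.2, fun h => ⟨(hY _ h).2, h⟩⟩
  have hcard : degCount n Y d = T.card := by
    have : Y.cells.filter (fun c => degree n c = d) = T.image (fun t => (n - d + t, t)) := by
      ext ⟨a, b⟩
      rw [Finset.mem_filter, YoungDiagram.mem_cells]
      simp only [Finset.mem_image, hmem, degree, Prod.mk.injEq]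
      constructor
      · rintro ⟨h, hdeg⟩
        have : n - d + b = a := by omega
        exact ⟨b, this ▸ h, this, rfl⟩
      · rintro ⟨s, hs, rfl, rfl⟩
        exact ⟨hs, by omega⟩
    rw [degCount, this, Finset.card_image_of_injective]
    intro s t h
    exact (Prod.mk.inj h).2
  have hlow : ∀ s t, s ≤ t → t ∈ T → s ∈ T := fun s t hst ht => by
    rw [hmem] at ht ⊢
    exact Y.isLowerSet (show ((n - d + s, s) : ℕ × ℕ) ≤ (n - d + t, t) from ⟨by simpa, hst⟩) ht
  rw [hcard, ← hmem]
  conv_lhs => rw [eq_range_card hlow]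
  exact Finset.mem_range

/-- The corner of this diagonal would lie in row `n`, just outside the box. -/
theorem degCount_zero {Y : YoungDiagram} (hY : InBox n Y) : degCount n Y 0 = 0 := by
  by_contra h
  have := (hY _ ((mem_iff_lt_degCount hY (Nat.zero_le n)).2 (Nat.pos_of_ne_zero h))).1
  simp at this

/-- The vertex directly above one of degree `d` has degree `d + 1` and lies in the same column. -/
theorem degCount_le_succ {Y : YoungDiagram} (hY : InBox n Y) {d : ℕ} (hd : d < n) :
    degCount n Y d ≤ degCount n Y (d + 1) := by
  refine le_of_forall_lt fun t ht => ?_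
  rw [← mem_iff_lt_degCount hY (by omega)] at ht ⊢
  exact Y.isLowerSet (show ((n - (d + 1) + t, t) : ℕ × ℕ) ≤ (n - d + t, t) from
    ⟨by simp only; omega, le_rfl⟩) ht

/-- Every vertex of degree `d + 1` except the first has a left neighbour of degree `d`. -/
theorem degCount_succ_le {Y : YoungDiagram} (hY : InBox n Y) {d : ℕ} (hd : d < n) :
    degCount n Y (d + 1) ≤ degCount n Y d + 1 := by
  by_contra h
  have h1 : degCount n Y d + 1 < degCount n Y (d + 1) := by omega
  rw [← mem_iff_lt_degCount hY (by omega)] at h1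
  refine lt_irrefl (degCount n Y d) ((mem_iff_lt_degCount hY hd.le).1 ?_)
  exact Y.isLowerSet (show ((n - d + degCount n Y d, degCount n Y d) : ℕ × ℕ) ≤
    (n - (d + 1) + (degCount n Y d + 1), degCount n Y d + 1) from
    ⟨by simp only; omega, by simp⟩) h1

/-- The self-conjugate diagram `Y` is determined by its numbers of vertices of given degree. -/
theorem mem_iff_min_lt (Y : SelfConj n) (a b : ℕ) :
    (a, b) ∈ Y.1 ↔ min a b < degCount n Y.1 (n - (max a b - min a b)) := by
  have hswap : (a, b) ∈ Y.1 ↔ (b, a) ∈ Y.1 := by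
    conv_lhs => rw [← Y.2.2]
    exact YoungDiagram.mem_transpose
  by_cases hab : max a b - min a b ≤ n
  · rw [← mem_iff_lt_degCount Y.2.1 (by omega)]
    rcases le_total a b with h | h
    · rw [hswap]
      congr! 2 <;> omega
    · congr! 2 <;> omega
  · rw [show n - (max a b - min a b) = 0 by omega, degCount_zero Y.2.1]
    refine iff_of_false (fun h => ?_) (by omega)
    have := Y.2.1 _ h
    simp only at this
    omega

/-! ### From diagrams to subsets and back -/

/-- The number of elements of `S` less than `d`. -/
def countBelow (S : Finset (Fin n)) (d : ℕ) : ℕ := (S.filter (fun i : Fin n => (i : ℕ) < d)).card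

theorem countBelow_zero (S : Finset (Fin n)) : countBelow S 0 = 0 := by simp [countBelow]

theorem countBelow_succ (S : Finset (Fin n)) (i : Fin n) :
    countBelow S (i + 1) = countBelow S i + if i ∈ S then 1 else 0 := by
  unfold countBelow
  by_cases hi : i ∈ S
  · have : S.filter (fun j : Fin n => (j : ℕ) < i + 1) =
        insert i (S.filter (fun j : Fin n => (j : ℕ) < i)) := by
      ext j
      simp only [Finset.mem_filter, Finset.mem_insert, Fin.ext_iff]
      constructor
      · rintro ⟨h1, h2⟩
        by_cases h : (j : ℕ) = i
        · exact Or.inl h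
        · exact Or.inr ⟨h1, by omega⟩
      · rintro (h | ⟨h1, h2⟩)
        · rw [Fin.ext h]
          exact ⟨hi, by omega⟩
        · exact ⟨h1, by omega⟩
    rw [this, Finset.card_insert_of_notMem (by simp), if_pos hi]
  · rw [if_neg hi, add_zero]
    congr 1
    refine Finset.filter_congr fun j hj => ?_
    have : (j : ℕ) ≠ i := fun h => hi (Fin.ext h ▸ hj)
    omega

theorem countBelow_le_add (S : Finset (Fin n)) {d d' : ℕ} (h : d' ≤ d) (hd : d ≤ n) :
    countBelow S d ≤ countBelow S d' + (d - d') := by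
  induction d, h using Nat.le_induction with
  | base => simp
  | succ e he ih =>
    have := countBelow_succ S ⟨e, hd⟩
    simp only at this
    have h' := ih (by omega)
    split_ifs at this <;> omega

theorem countBelow_mono (S : Finset (Fin n)) {d d' : ℕ} (h : d ≤ d') :
    countBelow S d ≤ countBelow S d' :=
  Finset.card_le_card fun i hi => by
    simp only [Finset.mem_filter] at hi ⊢
    exact ⟨hi.1, by omega⟩

theorem countBelow_le (S : Finset (Fin n)) {d : ℕ} (hd : d ≤ n) : countBelow S d ≤ d := by
  simpa [countBelow_zero] using countBelow_le_add S (Nat.zero_le d) hd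

/-- The set of `i` such that `Y` has more vertices of degree `i + 1` than of degree `i`. -/
def toSet (Y : SelfConj n) : Finset (Fin n) :=
  Finset.univ.filter fun i : Fin n => degCount n Y.1 i < degCount n Y.1 (i + 1)

theorem degCount_succ (Y : SelfConj n) (i : Fin n) :
    degCount n Y.1 (i + 1) = degCount n Y.1 i + if i ∈ toSet Y then 1 else 0 := by
  have h1 := degCount_le_succ Y.2.1 i.2
  have h2 := degCount_succ_le Y.2.1 i.2
  simp only [toSet, Finset.mem_filter, Finset.mem_univ, true_and]
  split_ifs <;> omega

theorem degCount_eq_countBelow (Y : SelfConj n) {d : ℕ} (hd : d ≤ n) :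
    degCount n Y.1 d = countBelow (toSet Y) d := by
  induction d with
  | zero => rw [degCount_zero Y.2.1, countBelow_zero]
  | succ d ih =>
    have h1 := degCount_succ Y ⟨d, hd⟩
    have h2 := countBelow_succ (toSet Y) ⟨d, hd⟩
    simp only at h1 h2
    rw [h1, h2, ih (by omega)]

/-- The diagram attached to a subset. -/
def ofSetDiagram (S : Finset (Fin n)) : YoungDiagram where
  cells := (Finset.range n ×ˢ Finset.range n).filter
    fun c => min c.1 c.2 < countBelow S (n - (max c.1 c.2 - min c.1 c.2))
  isLowerSet := by
    rintro ⟨a, b⟩ ⟨a', b'⟩ ⟨ha, hb⟩ h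
    simp only [Finset.coe_filter, Finset.mem_product, Finset.mem_range, Set.mem_ofPred_eq]
      at h ha hb ⊢
    refine ⟨by omega, ?_⟩
    -- If the smaller cell is no farther from the diagonal, the count only grows. Otherwise the
    -- count drops by at most the added distance, which is at most the drop in the minimum, because
    -- the maximum does not increase.
    rcases le_total (n - (max a b - min a b)) (n - (max a' b' - min a' b')) with hd | hd
    · have := countBelow_mono S hd
      omega
    · have := countBelow_le_add S hd (by omega)
      omega

/-- The box condition is automatic: at most `d` elements lie below `d`, so the inequality already
forces `max a b < n`. -/
theorem mem_ofSetDiagram (S : Finset (Fin n)) (a b : ℕ) :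
    (a, b) ∈ ofSetDiagram S ↔ min a b < countBelow S (n - (max a b - min a b)) := by
  rw [← YoungDiagram.mem_cells]
  simp only [ofSetDiagram, Finset.mem_filter, Finset.mem_product, Finset.mem_range]
  refine ⟨fun h => h.2, fun h => ⟨?_, h⟩⟩
  have := countBelow_le S (d := n - (max a b - min a b)) (by omega)
  omega

/-- The self-conjugate diagram attached to a subset. -/
def ofSet (S : Finset (Fin n)) : SelfConj n :=
  ⟨ofSetDiagram S, by
    rintro ⟨a, b⟩ h
    rw [← YoungDiagram.mem_cells] at h
    simp only [ofSetDiagram, Finset.mem_filter, Finset.mem_product, Finset.mem_range] at h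
    exact h.1, by
    apply YoungDiagram.ext
    ext ⟨a, b⟩
    rw [YoungDiagram.mem_cells, YoungDiagram.mem_cells, YoungDiagram.mem_transpose,
      Prod.swap_prod_mk, mem_ofSetDiagram, mem_ofSetDiagram, min_comm, max_comm]⟩

theorem degCount_ofSet (S : Finset (Fin n)) {d : ℕ} (hd : d ≤ n) :
    degCount n (ofSet S).1 d = countBelow S d := by
  refine eq_of_forall_lt_iff fun t => ?_
  rw [← mem_iff_lt_degCount (ofSet S).2.1 hd]
  refine (mem_ofSetDiagram S _ _).trans ?_
  congr! 2 <;> omega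

theorem toSet_ofSet (S : Finset (Fin n)) : toSet (ofSet S) = S := by
  ext i
  have := countBelow_succ S i
  rw [toSet, Finset.mem_filter, degCount_ofSet S i.2.le, degCount_ofSet S i.2, this]
  split_ifs <;> simp_all

theorem ofSet_toSet (Y : SelfConj n) : ofSet (toSet Y) = Y := by
  apply Subtype.ext
  apply YoungDiagram.ext
  ext ⟨a, b⟩
  rw [YoungDiagram.mem_cells, YoungDiagram.mem_cells, mem_iff_min_lt, mem_iff_min_lt,
    degCount_ofSet _ (by omega), degCount_eq_countBelow Y (by omega)]

/-- Self-conjugate diagrams in the `n × n` box correspond to subsets of an `n`-element set. -/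
def diagramEquiv (n : ℕ) : SelfConj n ≃ Finset (Fin n) where
  toFun := toSet
  invFun := ofSet
  left_inv := ofSet_toSet
  right_inv := toSet_ofSet

/-! ### Adding vertices as a move on subsets; weights -/

/-- Adding vertices of given degrees, in terms of the numbers of vertices. -/
theorem adds_iff_degCount (k : Fin n) (Y Y' : SelfConj n) :
    Adds k Y.1 Y'.1 ↔
      ∀ d ≤ n, degCount n Y'.1 d = degCount n Y.1 d + if d = k + 1 then 1 else 0 := by
  have hk := k.2
  constructor
  · intro h d hd
    unfold Adds at h
    split_ifs at h with hkn
    · obtain ⟨a, b, ha, hb, hab, haY, hbY, e⟩ := h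
      -- The mirror vertex has degree `2n - (k + 1) > n`, beyond the counted range.
      have hbd : degree n b ≠ d := by omega
      unfold degCount
      rw [e, Finset.filter_insert, Finset.filter_insert, if_neg hbd]
      by_cases hdk : d = k + 1
      · rw [if_pos (by rw [ha, hdk]; push_cast; rfl), if_pos hdk,
          Finset.card_insert_of_notMem (by simp only [Finset.mem_filter]; tauto)]
      · rw [if_neg (by omega), if_neg hdk, add_zero]
    · obtain ⟨a, ha, haY, e⟩ := h
      unfold degCount
      rw [e, Finset.filter_insert]
      by_cases hdk : d = k + 1
      · rw [if_pos (by omega), if_pos hdk,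
          Finset.card_insert_of_notMem (by simp only [Finset.mem_filter]; tauto)]
      · rw [if_neg (by omega), if_neg hdk, add_zero]
  · intro h
    -- The diagonal of degree `k + 1` is filled up to position `t`, so the new vertex goes exactly
    -- there.
    set t := degCount n Y.1 (k + 1) with ht
    have hmem : ∀ a b, (a, b) ∈ Y'.1 ↔
        (a, b) ∈ Y.1 ∨ (min a b = t ∧ n - (max a b - min a b) = k + 1) := by
      intro a b
      rw [mem_iff_min_lt, mem_iff_min_lt, h _ (by omega)]
      split_ifs with hd
      · rw [hd, ← ht]; omega
      · omega
    have hnot : ∀ a b, min a b = t → n - (max a b - min a b) = k + 1 → (a, b) ∉ Y.1 := by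
      intro a b h1 h2 h3
      rw [mem_iff_min_lt, h2, ← ht] at h3
      omega
    unfold Adds
    split_ifs with hkn
    · refine ⟨(n - (k + 1) + t, t), (t, n - (k + 1) + t), ?_, ?_, ?_, ?_, ?_, ?_⟩
      · simp only [degree]; omega
      · simp only [degree]; omega
      · simp only [ne_eq, Prod.mk.injEq]; omega
      · exact hnot _ _ (by omega) (by omega)
      · exact hnot _ _ (by omega) (by omega)
      · ext ⟨a, b⟩
        rw [Finset.mem_insert, Finset.mem_insert, YoungDiagram.mem_cells, hmem,
          YoungDiagram.mem_cells, Prod.mk.injEq, Prod.mk.injEq]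
        constructor
        · rintro (h1 | ⟨h1, h2⟩)
          · exact Or.inr (Or.inr h1)
          · omega
        · rintro (h1 | h1 | h1)
          · right; omega
          · right; omega
          · exact Or.inl h1
    · refine ⟨(t, t), ?_, ?_, ?_⟩
      · simp only [degree]; omega
      · exact hnot _ _ (by omega) (by omega)
      · ext ⟨a, b⟩
        rw [Finset.mem_insert, YoungDiagram.mem_cells, hmem, YoungDiagram.mem_cells,
          Prod.mk.injEq]
        constructor
        · rintro (h1 | ⟨h1, h2⟩)
          · exact Or.inr h1
          · left; omega
        · rintro (h1 | h1)
          · right; omega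
          · exact Or.inl h1

/-- Adding vertices of given degrees, in terms of the indicator functions of the subsets. -/
theorem adds_iff_indicator (k : Fin n) (Y Y' : SelfConj n) :
    Adds k Y.1 Y'.1 ↔ ∀ i : Fin n,
      (if i ∈ toSet Y' then 1 else 0) + (if (i : ℕ) = k + 1 then 1 else 0) =
        (if i ∈ toSet Y then 1 else 0) + (if i = k then 1 else 0) := by
  rw [adds_iff_degCount]
  constructor
  · intro h i
    have h1 := h i i.2.le
    have h2 := h (i + 1) i.2
    rw [degCount_succ, degCount_succ, h1] at h2
    simp only [Nat.add_right_cancel_iff, ← Fin.ext_iff] at h2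
    omega
  · intro h d hd
    induction d with
    | zero => simp [degCount_zero Y.2.1, degCount_zero Y'.2.1]
    | succ d ih =>
      have h1 := degCount_succ Y ⟨d, hd⟩
      have h2 := degCount_succ Y' ⟨d, hd⟩
      have h3 := h ⟨d, hd⟩
      have h4 := ih (by omega)
      simp only [Fin.ext_iff] at h1 h2 h3
      rw [h1, h2, h4]
      simp only [Nat.add_right_cancel_iff]
      omega

/-- Raising only the count of degree `k + 1` raises the increment at `k` and lowers the one at `k +
1`. Increments are 0 or 1, so an element moves from `k + 1` to `k`. -/
theorem adds_iff_of_lt {k : Fin n} (hk : (k : ℕ) + 1 < n) (Y Y' : SelfConj n) :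
    Adds k Y.1 Y'.1 ↔ (k ∉ toSet Y ∧ ⟨k + 1, hk⟩ ∈ toSet Y) ∧
      toSet Y' = (insert k (toSet Y)).erase ⟨k + 1, hk⟩ := by
  rw [adds_iff_indicator]
  constructor
  · intro h
    have h1 := h k
    have h2 := h ⟨k + 1, hk⟩
    simp only [Fin.ext_iff] at h1 h2
    refine ⟨⟨fun h' => ?_, ?_⟩, ?_⟩
    · simp [h'] at h1
      split_ifs at h1
      all_goals omega
    · by_contra h'
      simp [h'] at h2
    · ext i
      have h3 := h i
      simp only [Finset.mem_erase, Finset.mem_insert, Fin.ext_iff, ne_eq] at h3 ⊢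
      grind
  · rintro ⟨⟨h1, h2⟩, h3⟩ i
    rw [h3]
    simp only [Finset.mem_erase, Finset.mem_insert, Fin.ext_iff, ne_eq]
    by_cases a1 : (i : ℕ) = k
    · have : i = k := Fin.ext a1
      simp [this, h1]
    · by_cases a2 : (i : ℕ) = k + 1
      · have : i = ⟨k + 1, hk⟩ := Fin.ext a2
        simp [this, h2]
      · simp [a1, a2]

theorem adds_iff_of_lt' {k : Fin n} (hk : (k : ℕ) + 1 < n) (Y Y' : SelfConj n) :
    Adds k Y.1 Y'.1 ↔ (k ∈ toSet Y' ∧ ⟨k + 1, hk⟩ ∉ toSet Y') ∧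
      toSet Y = (insert ⟨k + 1, hk⟩ (toSet Y')).erase k := by
  have hne : (⟨k + 1, hk⟩ : Fin n) ≠ k := by simp [Fin.ext_iff]
  rw [adds_iff_of_lt hk]
  constructor
  · rintro ⟨⟨h1, h2⟩, h3⟩
    rw [h3]
    refine ⟨⟨by simp [hne.symm], by simp⟩, ?_⟩
    rw [Finset.insert_erase (Finset.mem_insert_of_mem h2), Finset.erase_insert h1]
  · rintro ⟨⟨h1, h2⟩, h3⟩
    rw [h3]
    refine ⟨⟨by simp, by simp [hne]⟩, ?_⟩
    rw [Finset.insert_erase (Finset.mem_insert_of_mem h1), Finset.erase_insert h2]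

/-- At the last node no later increment is tracked, so only the insertion remains. -/
theorem adds_iff_of_not_lt {k : Fin n} (hk : ¬ (k : ℕ) + 1 < n) (Y Y' : SelfConj n) :
    Adds k Y.1 Y'.1 ↔ k ∉ toSet Y ∧ toSet Y' = insert k (toSet Y) := by
  have hne : ∀ i : Fin n, (i : ℕ) ≠ k + 1 := fun i => by omega
  rw [adds_iff_indicator]
  simp only [hne, if_false, add_zero]
  constructor
  · intro h
    have h1 := h k
    refine ⟨fun h' => ?_, ?_⟩
    · simp [h'] at h1
      split_ifs at h1
      omega
    · ext i
      have h3 := h i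
      rw [Finset.mem_insert]
      grind
  · rintro ⟨h1, h3⟩ i
    rw [h3]
    by_cases a1 : i = k
    · simp [a1, h1]
    · simp [a1]

theorem adds_iff_of_not_lt' {k : Fin n} (hk : ¬ (k : ℕ) + 1 < n) (Y Y' : SelfConj n) :
    Adds k Y.1 Y'.1 ↔ k ∈ toSet Y' ∧ toSet Y = (toSet Y').erase k := by
  rw [adds_iff_of_not_lt hk]
  constructor
  · rintro ⟨h1, h3⟩
    rw [h3, Finset.erase_insert h1]
    exact ⟨Finset.mem_insert_self _ _, rfl⟩
  · rintro ⟨h1, h3⟩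
    rw [h3, Finset.insert_erase h1]
    exact ⟨Finset.notMem_erase _ _, rfl⟩

/-- Uniqueness of the added vertices removes the dependence on choice. -/
theorem crystalF_eq_some_iff (k : Fin n) (Y Y' : SelfConj n) :
    crystalF k Y = some Y' ↔ Adds k Y.1 Y'.1 := by
  unfold crystalF
  split_ifs with h
  · rw [Option.some_inj, Subtype.ext_iff]
    exact ⟨fun e => e ▸ h.choose_spec.2, fun h' => h.choose_spec.2.unique h'⟩
  · exact iff_of_false (by simp) fun h' => h ⟨Y'.1, Y'.2.1, h'⟩

theorem crystalE_eq_some_iff (k : Fin n) (Y Y' : SelfConj n) :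
    crystalE k Y = some Y' ↔ Adds k Y'.1 Y.1 := by
  unfold crystalE
  split_ifs with h
  · rw [Option.some_inj, Subtype.ext_iff]
    exact ⟨fun e => e ▸ h.choose_spec.2, fun h' => h.choose_spec.2.unique_left h'⟩
  · exact iff_of_false (by simp) fun h' => h ⟨Y'.1, Y'.2.1, h'⟩

/-- Summation by parts: the `εᵢ` coordinate of the sum of roots is the difference of consecutive
counts, that is, the indicator of `i` in the subset. -/
theorem wt_apply (Y : SelfConj n) (i : Fin n) :
    wt Y i = 1 / 2 - if i ∈ toSet Y then 1 else 0 := by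
  have key : ∀ c : ℕ → ℂ, c 0 = 0 →
      ∑ k : Fin n, c (k + 1) * simpleRoot k i = c (i + 1) - c i := by
    intro c hc
    have hterm : ∀ k : Fin n, c (k + 1) * simpleRoot k i =
        (if i = k then c (k + 1) else 0) - if (i : ℕ) = k + 1 then c (k + 1) else 0 := by
      intro k
      have := i.2
      unfold simpleRoot
      split_ifs with h1 h2 h3 h3 h4 h5 h5
      all_goals simp_all [Pi.single_apply, Fin.ext_iff]
    simp only [hterm, Finset.sum_sub_distrib, Finset.sum_ite_eq, Finset.mem_univ, if_true]
    congr 1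
    -- For the first coordinate no preceding root contributes, and `c 0 = 0` stands in for it.
    rcases Nat.eq_zero_or_pos (i : ℕ) with h0 | h0
    · rw [h0, hc]
      exact Finset.sum_eq_zero fun k _ => by simp
    · rw [Finset.sum_eq_single ⟨i - 1, by omega⟩]
      · simp only
        rw [if_pos (by omega), Nat.sub_add_cancel h0]
      · intro k _ hk
        rw [if_neg]
        intro h
        apply hk
        ext
        simp only
        omega
      · simp
  have h := key (fun d => (degCount n Y.1 d : ℂ)) (by simp [degCount_zero Y.2.1])
  have h2 := degCount_succ Y i
  rw [h2] at h
  have hwt : wt Y i = 1 / 2 - ∑ k : Fin n, (degCount n Y.1 (k + 1) : ℂ) * simpleRoot k i := by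
    simp [wt, spinWeight, degCount, Finset.sum_apply]
  rw [hwt, h]
  push_cast
  ring

end Diagrams

/-! ## The representation on the diagram space -/

section DiagramRep

variable {n : ℕ}

theorem opE_single (k : Fin n) (Y : SelfConj n) :
    opE k (Finsupp.single Y 1) = diagramVec (crystalE k Y) := by
  simp [opE]

theorem opF_single (k : Fin n) (Y : SelfConj n) :
    opF k (Finsupp.single Y 1) = diagramVec (crystalF k Y) := by
  simp [opF]

theorem opH_single (k : Fin n) (Y : SelfConj n) :
    opH k (Finsupp.single Y 1) = pairing k (wt Y) • Finsupp.single Y 1 := by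
  simp [opH, diagramVec]

/-- The diagram space is the Fock space. -/
def fockEquiv (n : ℕ) : DiagramSpace n ≃ₗ[ℂ] Fock n := Finsupp.domLCongr (diagramEquiv n)

theorem fockEquiv_single (Y : SelfConj n) :
    fockEquiv n (Finsupp.single Y 1) = Finsupp.single (toSet Y) 1 := by
  simp [fockEquiv, diagramEquiv]

theorem fockEquiv_diagramVec {o : Option (SelfConj n)} {S : Finset (Fin n)} {p : Prop}
    [Decidable p] (h : ∀ Y, o = some Y ↔ p ∧ toSet Y = S) :
    fockEquiv n (diagramVec o) = if p then Finsupp.single S 1 else 0 := by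
  split_ifs with hp
  · rw [(h (ofSet S)).2 ⟨hp, toSet_ofSet S⟩, diagramVec, fockEquiv_single, toSet_ofSet]
  · cases o with
    | none => simp [diagramVec]
    | some Y => exact absurd ((h Y).1 rfl).1 hp

theorem fockEquiv_opE (k : Fin n) (Y : SelfConj n) :
    fockEquiv n (opE k (Finsupp.single Y 1)) =
      fockRep n (chevE k) (Finsupp.single (toSet Y) 1) := by
  rw [opE_single]
  by_cases h : (k : ℕ) + 1 < n
  · rw [fockRep_chevE_of_lt h]
    exact fockEquiv_diagramVec fun Y' => by rw [crystalE_eq_some_iff, adds_iff_of_lt' h]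
  · rw [fockRep_chevE_of_not_lt h]
    exact fockEquiv_diagramVec fun Y' => by rw [crystalE_eq_some_iff, adds_iff_of_not_lt' h]

theorem fockEquiv_opF (k : Fin n) (Y : SelfConj n) :
    fockEquiv n (opF k (Finsupp.single Y 1)) =
      fockRep n (chevF k) (Finsupp.single (toSet Y) 1) := by
  rw [opF_single]
  by_cases h : (k : ℕ) + 1 < n
  · rw [fockRep_chevF_of_lt h]
    exact fockEquiv_diagramVec fun Y' => by rw [crystalF_eq_some_iff, adds_iff_of_lt h]
  · rw [fockRep_chevF_of_not_lt h]
    exact fockEquiv_diagramVec fun Y' => by rw [crystalF_eq_some_iff, adds_iff_of_not_lt h]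

theorem fockEquiv_opH (k : Fin n) (Y : SelfConj n) :
    fockEquiv n (opH k (Finsupp.single Y 1)) =
      fockRep n (chevH k) (Finsupp.single (toSet Y) 1) := by
  rw [opH_single, map_smul, fockEquiv_single]
  by_cases h : (k : ℕ) + 1 < n
  · rw [chevH_of_lt h, map_sub, LinearMap.sub_apply, fockRep_cartan, fockRep_cartan, ← sub_smul,
      pairing, dif_pos h, wt_apply, wt_apply]
  · rw [chevH_of_not_lt h, map_smul, LinearMap.smul_apply, fockRep_cartan, smul_smul, pairing,
      dif_neg h, wt_apply]

/-- The spin representation on the diagram space. -/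
def diagramRep (n : ℕ) : so n →ₗ⁅ℂ⁆ Module.End ℂ (DiagramSpace n) :=
  (fockEquiv n).symm.lieConj.toLieHom.comp (fockRep n)

theorem diagramRep_apply (x : so n) (z : DiagramSpace n) :
    diagramRep n x z = (fockEquiv n).symm (fockRep n x (fockEquiv n z)) := rfl

theorem actsByCrystal_diagramRep (n : ℕ) : ActsByCrystal (diagramRep n) := by
  refine fun k => ⟨end_ext fun Y => ?_, end_ext fun Y => ?_, end_ext fun Y => ?_⟩
  · rw [diagramRep_apply, fockEquiv_single, LinearEquiv.symm_apply_eq, fockEquiv_opE]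
  · rw [diagramRep_apply, fockEquiv_single, LinearEquiv.symm_apply_eq, fockEquiv_opF]
  · rw [diagramRep_apply, fockEquiv_single, LinearEquiv.symm_apply_eq, fockEquiv_opH]

/-- A representation is determined by the action of the Chevalley generators. -/
theorem rep_ext {V : Type*} [AddCommGroup V] [Module ℂ V] {ρ σ : so n →ₗ⁅ℂ⁆ Module.End ℂ V}
    (hE : ∀ k, ρ (chevE k) = σ (chevE k)) (hF : ∀ k, ρ (chevF k) = σ (chevF k)) : ρ = σ := by
  let L : LieSubalgebra ℂ (so n) :=
    { carrier := {x | ρ x = σ x}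
      add_mem' := fun {a b} (ha : ρ a = σ a) (hb : ρ b = σ b) =>
        show ρ (a + b) = σ (a + b) by rw [map_add, map_add, ha, hb]
      zero_mem' := show ρ 0 = σ 0 by rw [map_zero, map_zero]
      smul_mem' := fun c a (ha : ρ a = σ a) =>
        show ρ (c • a) = σ (c • a) by rw [map_smul, map_smul, ha]
      lie_mem' := fun {a b} (ha : ρ a = σ a) (hb : ρ b = σ b) =>
        show ρ ⁅a, b⁆ = σ ⁅a, b⁆ by rw [LieHom.map_lie, LieHom.map_lie, ha, hb] }
  have h : L = ⊤ := eq_top_of_chevalley_mem L hE hF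
  ext1 x
  have hx : x ∈ L := h ▸ LieSubalgebra.mem_top x
  exact hx

/-! ## Irreducibility -/

theorem card_lt_of_adds {k : Fin n} {Y Y' : YoungDiagram} (h : Adds k Y Y') :
    Y.card < Y'.card := by
  refine Finset.card_lt_card ?_
  unfold Adds at h
  split_ifs at h
  · obtain ⟨a, b, -, -, -, ha, -, e⟩ := h
    rw [Finset.ssubset_iff]
    refine ⟨a, ha, fun x hx => ?_⟩
    rw [e]
    simp only [Finset.mem_insert] at hx ⊢
    tauto
  · obtain ⟨a, -, ha, e⟩ := h
    rw [Finset.ssubset_iff]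
    exact ⟨a, ha, e.ge⟩

theorem crystalE_iff_crystalF (k : Fin n) (Y Y' : SelfConj n) :
    crystalE k Y = some Y' ↔ crystalF k Y' = some Y := by
  rw [crystalE_eq_some_iff, crystalF_eq_some_iff]

/-- The two crystal operators are mutually inverse partial bijections, so each coefficient of the
image is a single coefficient of `x` and no cancellation occurs. -/
theorem opE_apply (k : Fin n) (x : DiagramSpace n) (Y : SelfConj n) :
    opE k x Y = (crystalF k Y).elim 0 x := by
  classical
  induction x using Finsupp.induction_linear with
  | zero => cases crystalF k Y <;> simp
  | add x y hx hy =>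
    rw [map_add, Finsupp.add_apply, hx, hy]
    cases crystalF k Y <;> simp
  | single Z c =>
    have : (Finsupp.single Z c : DiagramSpace n) = c • Finsupp.single Z 1 := by simp
    rw [this, map_smul, opE_single, Finsupp.smul_apply]
    by_cases h : crystalE k Z = some Y
    · rw [h, (crystalE_iff_crystalF k Z Y).1 h]
      simp [diagramVec]
    · have h' : crystalF k Y ≠ some Z := fun e => h ((crystalE_iff_crystalF k Z Y).2 e)
      have h1 : diagramVec (crystalE k Z) Y = 0 := by
        cases hZ : crystalE k Z with
        | none => simp [diagramVec]
        | some Z' =>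
          have : Z' ≠ Y := fun e => h (e ▸ hZ)
          simp [diagramVec, this]
      rw [h1]
      cases hY : crystalF k Y with
      | none => simp
      | some Y' =>
        have : Z ≠ Y' := fun e => h' (e ▸ hY)
        simp [this]

/-- The empty diagram. -/
def emptyDiagram (n : ℕ) : SelfConj n := ofSet ∅

theorem exists_crystalE {Y : SelfConj n} (hY : Y ≠ emptyDiagram n) :
    ∃ k Y', crystalE k Y = some Y' := by
  have hne : (toSet Y).Nonempty := by
    rw [Finset.nonempty_iff_ne_empty]
    intro h
    exact hY (by rw [← ofSet_toSet Y, h]; rfl)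
  -- The successor of the largest element is absent, so this element can always move up, or be
  -- removed at the last node.
  set k := (toSet Y).max' hne with hk
  have hkY : k ∈ toSet Y := Finset.max'_mem _ hne
  refine ⟨k, ?_⟩
  by_cases h : (k : ℕ) + 1 < n
  · refine ⟨ofSet ((insert ⟨k + 1, h⟩ (toSet Y)).erase k), ?_⟩
    rw [crystalE_eq_some_iff, adds_iff_of_lt' h]
    refine ⟨⟨hkY, fun h' => ?_⟩, toSet_ofSet _⟩
    have : (k : ℕ) + 1 ≤ k := Finset.le_max' _ _ h'
    omega
  · refine ⟨ofSet ((toSet Y).erase k), ?_⟩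
    rw [crystalE_eq_some_iff, adds_iff_of_not_lt' h]
    exact ⟨hkY, toSet_ofSet _⟩

theorem crystalE_empty (k : Fin n) : crystalE k (emptyDiagram n) = none := by
  rw [Option.eq_none_iff_forall_ne_some]
  intro Y hY
  rw [crystalE_eq_some_iff] at hY
  by_cases h : (k : ℕ) + 1 < n
  · rw [adds_iff_of_lt' h] at hY
    simp [emptyDiagram, toSet_ofSet] at hY
  · rw [adds_iff_of_not_lt' h] at hY
    simp [emptyDiagram, toSet_ofSet] at hY

theorem wt_empty : wt (emptyDiagram n) = spinWeight n := by
  ext i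
  simp [wt_apply, emptyDiagram, toSet_ofSet, spinWeight]

/-- Induction on a bound for the sizes in the support. If `Y` is a nonempty diagram in the support,
some `ẽₖ` acts on it; applying `opE k` keeps its coefficient, so the result is nonzero, and every
diagram that survives gets smaller. -/
theorem single_empty_mem (W : Submodule ℂ (DiagramSpace n))
    (hE : ∀ k, ∀ z ∈ W, opE k z ∈ W) (N : ℕ) :
    ∀ x ∈ W, x ≠ 0 → (∀ Y, x Y ≠ 0 → Y.1.card < N) →
      Finsupp.single (emptyDiagram n) 1 ∈ W := by
  induction N with
  | zero =>
    intro x _ hx0 hN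
    exact absurd (Finsupp.ext fun Y => by_contra fun h => absurd (hN Y h) (Nat.not_lt_zero _)) hx0
  | succ N ih =>
    intro x hx hx0 hN
    by_cases h : ∃ Y, x Y ≠ 0 ∧ Y ≠ emptyDiagram n
    · obtain ⟨Y, hxY, hY⟩ := h
      obtain ⟨k, Y', hk⟩ := exists_crystalE hY
      have hY' : opE k x Y' = x Y := by
        rw [opE_apply, (crystalE_iff_crystalF k Y Y').1 hk]
        rfl
      refine ih (opE k x) (hE k x hx) (fun h0 => hxY ?_) fun Z hZ => ?_
      · rw [← hY', h0]
        rfl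
      · rw [opE_apply] at hZ
        cases hFZ : crystalF k Z with
        | none => simp [hFZ] at hZ
        | some Z' =>
          rw [hFZ] at hZ
          have h1 := hN Z' hZ
          have h2 := card_lt_of_adds ((crystalF_eq_some_iff k Z Z').1 hFZ)
          omega
    · push Not at h
      have hx1 : x = x (emptyDiagram n) • Finsupp.single (emptyDiagram n) 1 := by
        ext Y
        by_cases hY : Y = emptyDiagram n
        · simp [hY]
        · have : x Y = 0 := by_contra fun h' => hY (h Y h')
          simp [this, Ne.symm hY]
      have hc : x (emptyDiagram n) ≠ 0 := fun hc => hx0 (by rw [hx1, hc, zero_smul])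
      rw [hx1] at hx
      exact (W.smul_mem_iff hc).1 hx

/-- A nonempty diagram is the image under some `f̃ₖ` of a smaller one, so the empty diagram
generates all of them. -/
theorem single_mem (W : Submodule ℂ (DiagramSpace n))
    (hF : ∀ k, ∀ z ∈ W, opF k z ∈ W) (h : Finsupp.single (emptyDiagram n) 1 ∈ W) (N : ℕ) :
    ∀ Y : SelfConj n, Y.1.card < N → Finsupp.single Y 1 ∈ W := by
  induction N with
  | zero => exact fun Y hY => absurd hY (Nat.not_lt_zero _)
  | succ N ih =>
    intro Y hY
    by_cases hY0 : Y = emptyDiagram n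
    · exact hY0 ▸ h
    obtain ⟨k, Y', hk⟩ := exists_crystalE hY0
    rw [crystalE_iff_crystalF] at hk
    have h1 := card_lt_of_adds ((crystalF_eq_some_iff k Y' Y).1 hk)
    have h2 := hF k _ (ih Y' (by omega))
    rwa [opF_single, hk] at h2

variable {ρ : so n →ₗ⁅ℂ⁆ Module.End ℂ (DiagramSpace n)}

theorem ActsByCrystal.isIrreducibleRep (hρ : ActsByCrystal ρ) : IsIrreducibleRep ρ := by
  refine ⟨⟨Finsupp.single (emptyDiagram n) 1, 0, by simp⟩, fun W hW => ?_⟩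
  have hE : ∀ k, ∀ z ∈ W, opE k z ∈ W := fun k z hz => (hρ k).1 ▸ hW (chevE k) z hz
  have hF : ∀ k, ∀ z ∈ W, opF k z ∈ W := fun k z hz => (hρ k).2.1 ▸ hW (chevF k) z hz
  refine or_iff_not_imp_left.2 fun hbot => ?_
  obtain ⟨x, hx, hx0⟩ := W.exists_mem_ne_zero_of_ne_bot hbot
  have hempty := single_empty_mem W hE (x.support.sup (fun Y => Y.1.card) + 1) x hx hx0
    fun Y hY => Nat.lt_succ_of_le
      (Finset.le_sup (f := fun Y : SelfConj n => Y.1.card) (Finsupp.mem_support_iff.2 hY))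
  rw [eq_top_iff]
  intro z _
  rw [← Finsupp.sum_single z]
  refine sum_mem fun Y _ => ?_
  have := W.smul_mem (z Y) (single_mem W hF hempty (Y.1.card + 1) Y (Nat.lt_succ_self _))
  simpa using this

theorem ActsByCrystal.isHighestWeightVector (hρ : ActsByCrystal ρ) :
    IsHighestWeightVector ρ (spinWeight n) (Finsupp.single (emptyDiagram n) 1) := by
  refine ⟨by simp, fun k => ?_, fun k => ?_⟩
  · rw [(hρ k).1, opE_single, crystalE_empty]
    rfl
  · rw [(hρ k).2.2, opH_single, wt_empty]

end DiagramRep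

end SpinRep

end

theorem mainTheorem8 (n : ℕ) (hn : 1 ≤ n) :
    (∃! ρ : SpinRep.so n →ₗ⁅ℂ⁆ Module.End ℂ (SpinRep.DiagramSpace n),
      SpinRep.ActsByCrystal ρ) ∧
    ∀ ρ : SpinRep.so n →ₗ⁅ℂ⁆ Module.End ℂ (SpinRep.DiagramSpace n),
      SpinRep.ActsByCrystal ρ →
        SpinRep.IsIrreducibleRep ρ ∧
        (∃ v, SpinRep.IsHighestWeightVector ρ (SpinRep.spinWeight n) v) ∧
        SpinRep.RepIso ρ (SpinRep.irrepAction (SpinRep.spinWeight n)) := by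
  refine ⟨⟨SpinRep.diagramRep n, SpinRep.actsByCrystal_diagramRep n, fun ρ hρ => ?_⟩,
    fun ρ hρ => ⟨hρ.isIrreducibleRep, ⟨_, hρ.isHighestWeightVector⟩,
      SpinRep.repIso_irrepAction ρ _ _ hρ.isIrreducibleRep hρ.isHighestWeightVector⟩⟩
  have h := SpinRep.actsByCrystal_diagramRep n
  exact SpinRep.rep_ext (fun k => (hρ k).1.trans (h k).1.symm)
    fun k => (hρ k).2.1.trans (h k).2.1.symm
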